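/- Let $0<\alpha<1$, and let $$\phi_\alpha(s)=\Bigl(1-\sum_{n\ge1}\frac{\alpha}{n-\alpha}\,\frac{(is)^n}{n!}\Bigr)^{-1},\qquad s\in\mathbb R .$$ The Darling--Mandelbrot law of parameter $\alpha$, that is, the probability law on $\mathbb R_+$ with characteristic function $\phi_\alpha$, has a unique density $g$ that is continuous on $(0,\infty)$ and zero on $(-\infty,0]$. Put $C_0=\sin(\alpha\pi)/\pi$ and $(f*f)(x)=\int_{\mathbb R} f(y)f(x-y)\,dy$; for $f=g$ this integral converges for every $x\in\mathbb R$. Consider the functions $f:\mathbb R\to\mathbb R$ that are zero on $(-\infty,0]$, continuous on $(0,\infty)$, and differentiable at every non-integer $x>0$ with $$x f'(x)+(1-\alpha)f(x)=-\alpha\,(f*f)(x-1)\qquad(x>0,\ x\notin\mathbb N).$$ Then $g$ is such a function and $g(x)=C_0x^{\alpha-1}+O(1)$ as $x\to0^+$; in particular $g(x)\sim C_0x^{\alpha-1}$. Conversely, $g$ is the only such function $f$ with $f(x)\sim C_0x^{\alpha-1}$ as $x\to0^+$ (hence the only one with $f(x)=C_0x^{\alpha-1}+O(1)$). Moreover,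 $x\mapsto x^{1-\alpha}g(x)$ is nonincreasing on $(0,\infty)$. -/

import Mathlib

open MeasureTheory Set Filter Topology Asymptotics
open scoped Convolution

noncomputable section

namespace DarlingMandelbrot

/-- The function `φ_α(s) = (1 - ∑_{n ≥ 1} α / (n - α) * (i s)^n / n!)⁻¹`
(the sum is indexed by `n + 1`, `n : ℕ`). -/
def phi (α s : ℝ) : ℂ :=
  (1 - ∑' n : ℕ, ((α / ((n : ℝ) + 1 - α) : ℝ) : ℂ) *
    ((Complex.I * (s : ℂ)) ^ (n + 1) / (Nat.factorial (n + 1) : ℂ)))⁻¹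

/-- The Darling–Mandelbrot law of parameter `α`: the probability measure with characteristic
function `φ_α`. -/
structure IsLaw (α : ℝ) (μ : Measure ℝ) : Prop where
  isProbabilityMeasure : IsProbabilityMeasure μ
  charFun_eq : ∀ s : ℝ, charFun μ s = phi α s

/-- `g` is the continuous density on `(0, ∞)` of the Darling–Mandelbrot law of parameter `α`,
extended by `0` to `(-∞, 0]`. -/
structure IsDensity (α : ℝ) (g : ℝ → ℝ) : Prop where
  nonneg : ∀ x, 0 ≤ g x
  eq_zero : ∀ x ≤ 0, g x = 0
  continuousOn : ContinuousOn g (Ioi 0)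
  isLaw : IsLaw α (volume.withDensity fun x => ENNReal.ofReal (g x))

/-- The convolution product `(f * h)(x) = ∫ f(y) h(x - y) dy` on the real line. -/
def conv (f h : ℝ → ℝ) : ℝ → ℝ :=
  f ⋆[ContinuousLinearMap.mul ℝ ℝ, volume] h

/-- `f`, supported on the positive half-line and continuous there, satisfies
`x f'(x) + (1 - α) f(x) = -α (f * f)(x - 1)` at every non-integer `x > 0`. -/
structure IsContinuousSolution (α : ℝ) (f : ℝ → ℝ) : Prop where
  eq_zero : ∀ x ≤ 0, f x = 0
  continuousOn : ContinuousOn f (Ioi 0)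
  equation : ∀ x : ℝ, 0 < x → (∀ n : ℕ, x ≠ n) →
    DifferentiableAt ℝ f x ∧
      x * deriv f x + (1 - α) * f x = -α * conv f f (x - 1)

/-- The constant `C₀ = sin(α π) / π`. -/
def C₀ (α : ℝ) : ℝ := Real.sin (α * Real.pi) / Real.pi

end DarlingMandelbrot

end

/-! Write `φ(s) = 1/ψ(is)` with `ψ` entire, and let `K(z) = ∫₀¹ y^{-α} e^{zy} dy`. Two identities of
power series drive the proof: `ψ' = -αK` and `ψ(z) = e^z - zK(z)`. The first gives `φ' = iαKφ²`: if
`X` has law `μ`, the size-biased measure `x μ(dx)` is `α k * μ * μ` with `k = x^{-α}` on `(0, 1]`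
(`IsLaw.withDensity_id_eq`). The second, combined with `ψφ = 1`, says that `k * μ` has density `P(X
> x - 1)` on `x > 0` (`IsLaw.kernel_conv_eq`). Together they yield a density `g` with `x g(x) = α
(P(X < x) - P(X + X' ≤ x - 1))`, where `X'` is an independent copy of `X` (`IsLaw.mul_lawDensity`).
Continuity of `g` follows, and differentiating gives the equation.

Multiplied by `x^{-α}`, the equation reads `(x^{1-α} g)' = -α x^{-α} (g * g)(x - 1)`. The right side
is nonpositive, whence monotonicity. It vanishes on `(0, 1)`, where therefore `g = C x^{α-1}`
exactly; `k * μ` having density 1 there forces `C = C₀` by the Beta integral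
(`IsLaw.eq_C₀_of_lawDensity_eq`). The right side on `(n, n + 1)` involves only values on `(0, n)`,
so a solution is determined by its behaviour at the origin, one unit interval at a time
(`IsContinuousSolution.eq_of_isEquivalent`).

The law itself exists because `ψ(is) = 1 - α ∫₀¹ (e^{isx} - 1) x^{-α-1} dx`. Truncating the integral
to `(ε, 1]` gives the reciprocal characteristic function of a compound geometric law, and these laws
are tight as `ε → 0`. -/

noncomputable section

namespace DarlingMandelbrot

/-! ### The entire function `ψ`, its derivative and its integral form -/

section

/-- The entire function whose reciprocal on the imaginary axis is `φ_α`. -/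
def psi (α : ℝ) (z : ℂ) : ℂ :=
  1 - ∑' n : ℕ, ((α / ((n : ℝ) + 1 - α) : ℝ) : ℂ) * (z ^ (n + 1) / (Nat.factorial (n + 1) : ℂ))

/-- The entire function `∑ zⁿ / (n! (n + 1 - α))`, equal to `∫₀¹ y^{-α} e^{zy} dy`. -/
def kernelTransform (α : ℝ) (z : ℂ) : ℂ :=
  ∑' n : ℕ, z ^ n / (Nat.factorial n : ℂ) * ((1 / ((n : ℝ) + 1 - α) : ℝ) : ℂ)

lemma phi_eq_inv_psi (α s : ℝ) : phi α s = (psi α (Complex.I * s))⁻¹ := rfl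

variable {α : ℝ}

lemma norm_inv_sub_le (hα₁ : α < 1) (n : ℕ) :
    ‖((1 / ((n : ℝ) + 1 - α) : ℝ) : ℂ)‖ ≤ 1 / (1 - α) := by
  have h0 : (0 : ℝ) ≤ n := n.cast_nonneg
  rw [Complex.norm_real, Real.norm_of_nonneg (one_div_nonneg.2 (by linarith))]
  exact one_div_le_one_div_of_le (by linarith) (by linarith)

lemma summable_pow_div_factorial (z : ℂ) :
    Summable fun n : ℕ => ‖z ^ n / (Nat.factorial n : ℂ)‖ :=
  (NormedSpace.expSeries_div_summable z).norm

lemma hasSum_pow_div_factorial (z : ℂ) :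
    HasSum (fun n : ℕ => z ^ n / (Nat.factorial n : ℂ)) (Complex.exp z) := by
  rw [Complex.exp_eq_exp_ℂ]
  exact NormedSpace.expSeries_div_hasSum_exp z

lemma summable_kernelTransform (hα₁ : α < 1) (z : ℂ) :
    Summable fun n : ℕ => z ^ n / (Nat.factorial n : ℂ) * ((1 / ((n : ℝ) + 1 - α) : ℝ) : ℂ) := by
  refine Summable.of_norm_bounded ((summable_pow_div_factorial z).mul_right (1 / (1 - α))) fun n => ?_
  rw [norm_mul]
  gcongr
  exact norm_inv_sub_le hα₁ n

/-- Since `α/(n+1-α) = (n+1)/(n+1-α) - 1`, the series splits into `z K(z)` minus the tail `e^z - 1`.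
-/
lemma psi_eq_exp_sub (hα₁ : α < 1) (z : ℂ) :
    psi α z = Complex.exp z - z * kernelTransform α z := by
  have h1 := ((summable_kernelTransform hα₁ z).hasSum).mul_left z
  have h2 := (hasSum_nat_add_iff' (f := fun n : ℕ => z ^ n / (Nat.factorial n : ℂ)) 1).2
    (hasSum_pow_div_factorial z)
  have h3 := h1.sub h2
  have h4 : (fun n : ℕ => z * (z ^ n / (Nat.factorial n : ℂ) * ((1 / ((n : ℝ) + 1 - α) : ℝ) : ℂ))
      - z ^ (n + 1) / (Nat.factorial (n + 1) : ℂ)) = fun n : ℕ =>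
      ((α / ((n : ℝ) + 1 - α) : ℝ) : ℂ) * (z ^ (n + 1) / (Nat.factorial (n + 1) : ℂ)) := by
    funext n
    have hn : (n.factorial : ℂ) ≠ 0 := by exact_mod_cast n.factorial_ne_zero
    have hn' : (n : ℂ) + 1 ≠ 0 := by exact_mod_cast n.succ_ne_zero
    have hd : (n : ℂ) + 1 - α ≠ 0 := by
      have h0 : (0 : ℝ) ≤ n := n.cast_nonneg
      have : (0 : ℝ) < n + 1 - α := by linarith
      exact_mod_cast this.ne'
    rw [Nat.factorial_succ]
    push_cast
    field_simp
    ring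
  rw [h4] at h3
  rw [psi, h3.tsum_eq]
  simp only [Finset.range_one, Finset.sum_singleton, pow_zero, Nat.factorial_zero, Nat.cast_one,
    div_one, kernelTransform]
  ring

/-- Termwise differentiation on a ball around 0 containing `z`: the factor `n + 1` cancels into the
factorial, leaving the series of `K`. -/
lemma hasDerivAt_psi (hα₀ : 0 < α) (hα₁ : α < 1) (z : ℂ) :
    HasDerivAt (psi α) (-(α * kernelTransform α z)) z := by
  set R : ℝ := ‖z‖ + 1
  have hu : Summable fun n : ℕ => α * (‖(R : ℂ) ^ n / (Nat.factorial n : ℂ)‖ * (1 / (1 - α))) :=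
    ((summable_pow_div_factorial (R : ℂ)).mul_right _).mul_left _
  have hR : 0 < R := by positivity
  have key := hasDerivAt_tsum_of_isPreconnected (𝕜 := ℂ)
    (g := fun (n : ℕ) z => ((α / ((n : ℝ) + 1 - α) : ℝ) : ℂ) * (z ^ (n + 1) / (Nat.factorial (n + 1) : ℂ)))
    (g' := fun (n : ℕ) z => α * (z ^ n / (Nat.factorial n : ℂ) * ((1 / ((n : ℝ) + 1 - α) : ℝ) : ℂ)))
    (t := Metric.ball 0 R) (y₀ := 0) (y := z) hu Metric.isOpen_ball
    (convex_ball _ _).isPreconnected ?_ ?_ (by simp [hR]) ?_ (by simp [R])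
  · rw [tsum_mul_left] at key
    exact key.const_sub 1
  · intro n y _
    have h := ((hasDerivAt_pow (n + 1) y).div_const (Nat.factorial (n + 1) : ℂ)).const_mul
      ((α / ((n : ℝ) + 1 - α) : ℝ) : ℂ)
    refine h.congr_deriv ?_
    have hn : (n.factorial : ℂ) ≠ 0 := by exact_mod_cast n.factorial_ne_zero
    have hn' : (n : ℂ) + 1 ≠ 0 := by exact_mod_cast n.succ_ne_zero
    rw [Nat.factorial_succ]
    push_cast
    field_simp
  · intro n y hy
    have hy' : ‖y‖ ≤ ‖(R : ℂ)‖ := by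
      rw [Complex.norm_real, Real.norm_of_nonneg hR.le]
      exact (mem_ball_zero_iff.1 hy).le
    rw [norm_mul, norm_mul, Complex.norm_real, Real.norm_of_nonneg hα₀.le, norm_div, norm_div,
      norm_pow, norm_pow]
    gcongr
    exact norm_inv_sub_le hα₁ n
  · simp [summable_zero]

/-- Termwise integration of a power series against `x^{-α}` on `(0, 1)`. -/
lemma integral_tsum_mul_rpow (hα₁ : α < 1) {c : ℕ → ℂ} (hc : Summable fun n => ‖c n‖) :
    ∫ x in Ioc (0 : ℝ) 1, ∑' n, c n * ((x ^ ((n : ℝ) - α) : ℝ) : ℂ) =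
      ∑' n, c n * ((1 / ((n : ℝ) + 1 - α) : ℝ) : ℂ) := by
  have hexp : ∀ n : ℕ, (-1 : ℝ) < n - α := fun n => by
    have h0 : (0 : ℝ) ≤ n := n.cast_nonneg
    linarith
  have hint : ∀ n : ℕ, IntegrableOn (fun x : ℝ => x ^ ((n : ℝ) - α)) (Ioc 0 1) := fun n =>
    (intervalIntegrable_iff_integrableOn_Ioc_of_le zero_le_one).1
      (intervalIntegral.intervalIntegrable_rpow' (hexp n))
  have hval : ∀ n : ℕ, ∫ x in Ioc (0 : ℝ) 1, x ^ ((n : ℝ) - α) = 1 / ((n : ℝ) + 1 - α) := by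
    intro n
    have h := hexp n
    rw [← intervalIntegral.integral_of_le zero_le_one, integral_rpow (Or.inl h),
      Real.one_rpow, Real.zero_rpow (by linarith), sub_zero]
    ring_nf
  have hint' : ∀ n : ℕ, Integrable (fun x : ℝ => c n * ((x ^ ((n : ℝ) - α) : ℝ) : ℂ))
      (volume.restrict (Ioc 0 1)) := fun n => (hint n).ofReal.const_mul _
  have hnorm : ∀ n : ℕ, ∫ x in Ioc (0 : ℝ) 1, ‖c n * ((x ^ ((n : ℝ) - α) : ℝ) : ℂ)‖ =
      ‖c n‖ * (1 / ((n : ℝ) + 1 - α)) := by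
    intro n
    rw [← hval n, ← integral_const_mul]
    refine setIntegral_congr_fun measurableSet_Ioc fun x hx => ?_
    rw [norm_mul, Complex.norm_real, Real.norm_of_nonneg (Real.rpow_nonneg hx.1.le _)]
  have hs : Summable fun n => ∫ x in Ioc (0 : ℝ) 1, ‖c n * ((x ^ ((n : ℝ) - α) : ℝ) : ℂ)‖ := by
    refine Summable.of_norm_bounded (hc.mul_right (1 / (1 - α))) fun n => ?_
    rw [hnorm n, norm_mul, norm_norm]
    gcongr
    simpa only [Complex.norm_real] using norm_inv_sub_le hα₁ n
  rw [← integral_tsum_of_summable_integral_norm hint' hs]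
  refine tsum_congr fun n => ?_
  rw [integral_const_mul, integral_complex_ofReal, hval n]

lemma integral_rpow_mul_exp (hα₁ : α < 1) (z : ℂ) :
    ∫ x in Ioc (0 : ℝ) 1, ((x ^ (-α) : ℝ) : ℂ) * Complex.exp (z * x) = kernelTransform α z := by
  rw [kernelTransform, ← integral_tsum_mul_rpow hα₁ (summable_pow_div_factorial z)]
  refine setIntegral_congr_fun measurableSet_Ioc fun x hx => ?_
  rw [← (hasSum_pow_div_factorial (z * x)).tsum_eq, ← tsum_mul_left]
  refine tsum_congr fun n => ?_
  rw [sub_eq_add_neg, Real.rpow_add hx.1, Real.rpow_natCast, mul_pow]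
  push_cast
  ring

lemma exp_sub_one_div_eq_tsum (z : ℂ) {x : ℝ} (hx : 0 < x) :
    (Complex.exp (z * x) - 1) * ((x ^ (-α - 1) : ℝ) : ℂ) =
      ∑' n : ℕ, z ^ (n + 1) / (Nat.factorial (n + 1) : ℂ) * ((x ^ ((n : ℝ) - α) : ℝ) : ℂ) := by
  have h2 := (hasSum_nat_add_iff' (f := fun n : ℕ => (z * x) ^ n / (Nat.factorial n : ℂ)) 1).2
    (hasSum_pow_div_factorial (z * x))
  simp only [Finset.range_one, Finset.sum_singleton, pow_zero, Nat.factorial_zero, Nat.cast_one,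
    div_one] at h2
  rw [← (h2.mul_right _).tsum_eq]
  refine tsum_congr fun n => ?_
  rw [show (n : ℝ) - α = ((n + 1 : ℕ) : ℝ) + (-α - 1) by push_cast; ring, Real.rpow_add hx,
    Real.rpow_natCast, mul_pow]
  push_cast
  ring

lemma norm_exp_sub_one_mul_rpow_le (s : ℝ) {x : ℝ} (hx : 0 < x) :
    ‖(Complex.exp (Complex.I * s * x) - 1) * ((x ^ (-α - 1) : ℝ) : ℂ)‖ ≤ |s| * x ^ (-α) := by
  rw [norm_mul, Complex.norm_real, Real.norm_of_nonneg (Real.rpow_nonneg hx.le _), mul_assoc,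
    ← Complex.ofReal_mul]
  calc _ ≤ ‖s * x‖ * x ^ (-α - 1) := by
        gcongr
        exact Real.norm_exp_I_mul_ofReal_sub_one_le
    _ = |s| * x ^ (-α) := by
        rw [norm_mul, Real.norm_of_nonneg hx.le, Real.norm_eq_abs, Real.rpow_sub_one hx.ne']
        field_simp

lemma integrableOn_exp_sub_one (hα₁ : α < 1) (s : ℝ) :
    IntegrableOn (fun x : ℝ => (Complex.exp (Complex.I * s * x) - 1) * ((x ^ (-α - 1) : ℝ) : ℂ))
      (Ioc 0 1) := by
  have hb : IntegrableOn (fun x : ℝ => |s| * x ^ (-α)) (Ioc 0 1) :=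
    ((intervalIntegrable_iff_integrableOn_Ioc_of_le zero_le_one).1
      (intervalIntegral.intervalIntegrable_rpow' (by linarith))).const_mul _
  refine hb.mono' (Measurable.aestronglyMeasurable (by fun_prop)) ?_
  filter_upwards [ae_restrict_mem measurableSet_Ioc] with x hx
  exact norm_exp_sub_one_mul_rpow_le s hx.1

/-- The Lévy–Khintchine form, with Lévy density `α x^{-α-1}` on `(0, 1]`. It gives both the bounds
on `ψ` along the imaginary axis and the approximation by compound geometric laws. -/
lemma psi_eq_integral (hα₁ : α < 1) (z : ℂ) :
    psi α z = 1 - α * ∫ x in Ioc (0 : ℝ) 1,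
      (Complex.exp (z * x) - 1) * ((x ^ (-α - 1) : ℝ) : ℂ) := by
  rw [psi, setIntegral_congr_fun measurableSet_Ioc
    fun x hx => exp_sub_one_div_eq_tsum z hx.1, integral_tsum_mul_rpow hα₁
    ((summable_nat_add_iff 1).2 (summable_pow_div_factorial z)), ← tsum_mul_left]
  congr 1
  refine tsum_congr fun n => ?_
  push_cast
  ring

lemma one_le_re_psi (hα₀ : 0 < α) (hα₁ : α < 1) (s : ℝ) :
    1 ≤ (psi α (Complex.I * s)).re := by
  rw [psi_eq_integral hα₁, Complex.sub_re, Complex.one_re, Complex.re_ofReal_mul]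
  have h : (∫ x in Ioc (0 : ℝ) 1, (Complex.exp (Complex.I * s * x) - 1) *
      ((x ^ (-α - 1) : ℝ) : ℂ)).re ≤ 0 := by
    have := integral_re (𝕜 := ℂ) (integrableOn_exp_sub_one hα₁ s).integrable
    simp only [RCLike.re_to_complex] at this
    rw [← this]
    refine setIntegral_nonpos measurableSet_Ioc fun x hx => ?_
    rw [mul_comm, Complex.re_ofReal_mul]
    refine mul_nonpos_of_nonneg_of_nonpos (Real.rpow_nonneg hx.1.le _) ?_
    have hre : (Complex.exp (Complex.I * s * x)).re ≤ 1 := by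
      refine (Complex.re_le_norm _).trans_eq ?_
      rw [mul_assoc, mul_comm Complex.I, ← Complex.ofReal_mul, Complex.norm_exp_ofReal_mul_I]
    simpa using hre
  nlinarith

lemma psi_ne_zero (hα₀ : 0 < α) (hα₁ : α < 1) (s : ℝ) : psi α (Complex.I * s) ≠ 0 := fun h => by
  have := one_le_re_psi hα₀ hα₁ s
  rw [h, Complex.zero_re] at this
  linarith

/-- The square of `φ` produced by differentiating a reciprocal is the source of the convolution `f *
f` in the equation. -/
lemma hasDerivAt_phi (hα₀ : 0 < α) (hα₁ : α < 1) (s : ℝ) :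
    HasDerivAt (phi α) (Complex.I * (α * kernelTransform α (Complex.I * s) * phi α s ^ 2)) s := by
  have h1 : HasDerivAt (fun s : ℝ => Complex.I * (s : ℂ)) Complex.I s := by
    simpa using (Complex.ofRealCLM.hasDerivAt (x := s)).const_mul Complex.I
  have h2 := ((hasDerivAt_psi hα₀ hα₁ (Complex.I * s)).comp s h1).inv
    (c := fun s : ℝ => psi α (Complex.I * s)) (psi_ne_zero hα₀ hα₁ s)
  refine h2.congr_deriv ?_
  rw [phi_eq_inv_psi]
  have := psi_ne_zero hα₀ hα₁ s
  field_simp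

end

/-! ### Existence of the law by compound geometric approximation -/

section

variable {α : ℝ}

lemma integrable_exp_mul_I (μ : Measure ℝ) [IsFiniteMeasure μ] (s : ℝ) :
    Integrable (fun x : ℝ => Complex.exp (s * x * Complex.I)) μ := by
  refine (integrable_const (1 : ℝ)).mono' (Measurable.aestronglyMeasurable (by fun_prop)) ?_
  refine ae_of_all _ fun x => ?_
  rw [← Complex.ofReal_mul, Complex.norm_exp_ofReal_mul_I]

/-- Convolution powers of a measure on the line. -/
def convPow (ν : Measure ℝ) : ℕ → Measure ℝ
  | 0 => Measure.dirac 0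
  | n + 1 => convPow ν n ∗ ν

lemma conv_univ (μ ν : Measure ℝ) [SFinite ν] : (μ ∗ ν) univ = μ univ * ν univ := by
  rw [Measure.conv, Measure.map_apply measurable_add MeasurableSet.univ, preimage_univ,
    ← univ_prod_univ, Measure.prod_prod]

lemma conv_Iio_zero {μ ν : Measure ℝ} [SFinite μ] [SFinite ν] (hμ : μ (Iio 0) = 0)
    (hν : ν (Iio 0) = 0) : (μ ∗ ν) (Iio 0) = 0 := by
  rw [Measure.conv, Measure.map_apply measurable_add measurableSet_Iio]
  refine measure_mono_null (t := Iio 0 ×ˢ univ ∪ univ ×ˢ Iio 0) ?_ ?_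
  · rintro ⟨x, y⟩ h
    simp only [mem_preimage, mem_Iio, mem_union, mem_prod, mem_univ, and_true, true_and] at h ⊢
    by_contra! hc
    linarith
  · exact measure_union_null (by rw [Measure.prod_prod, hμ, zero_mul])
      (by rw [Measure.prod_prod, hν, mul_zero])

instance isFiniteMeasure_convPow (ν : Measure ℝ) [IsFiniteMeasure ν] (n : ℕ) :
    IsFiniteMeasure (convPow ν n) := by
  induction n with
  | zero => rw [convPow]; infer_instance
  | succ n ih => rw [convPow]; infer_instance

lemma convPow_univ (ν : Measure ℝ) [IsFiniteMeasure ν] (n : ℕ) :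
    convPow ν n univ = ν univ ^ n := by
  induction n with
  | zero => simp [convPow]
  | succ n ih => rw [convPow, conv_univ, ih, pow_succ]

lemma convPow_Iio_zero {ν : Measure ℝ} [IsFiniteMeasure ν] (hν : ν (Iio 0) = 0) (n : ℕ) :
    convPow ν n (Iio 0) = 0 := by
  induction n with
  | zero => simp [convPow]
  | succ n ih => exact conv_Iio_zero ih hν

lemma charFun_convPow (ν : Measure ℝ) [IsFiniteMeasure ν] (n : ℕ) (s : ℝ) :
    charFun (convPow ν n) s = charFun ν s ^ n := by
  induction n with
  | zero => simp [convPow, charFun_dirac]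
  | succ n ih => rw [convPow, charFun_conv, ih, pow_succ]

/-- The compound geometric law attached to a finite measure on the half-line. -/
lemma exists_compound_geometric (ν : Measure ℝ) [IsFiniteMeasure ν] (hν : ν (Iio 0) = 0) :
    ∃ μ : Measure ℝ, IsProbabilityMeasure μ ∧ μ (Iio 0) = 0 ∧
      ∀ s, charFun μ s = (1 + ν.real univ - charFun ν s)⁻¹ := by
  set m := ν univ with hm
  have hm_top : m ≠ ⊤ := measure_ne_top ν univ
  have h1m_top : 1 + m ≠ ⊤ := by simp [hm_top]
  have h1m : 1 + m ≠ 0 := by simp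
  -- The number of summands is geometric with ratio `r m`; `r + r m = 1` makes the mixture of
  -- convolution powers a probability.
  set r : ENNReal := (1 + m)⁻¹ with hr
  have hr_top : r ≠ ⊤ := by simp [hr]
  have hr0 : r ≠ 0 := by simp [hr, hm_top]
  have hrm : r + r * m = 1 := by
    rw [← mul_one_add, hr, ENNReal.inv_mul_cancel h1m h1m_top]
  have hrm_top : r * m ≠ ⊤ := ENNReal.mul_ne_top hr_top hm_top
  set μ : Measure ℝ := Measure.sum fun n => r ^ (n + 1) • convPow ν n with hμ
  have huniv : μ univ = 1 := by
    rw [hμ, Measure.sum_apply _ MeasurableSet.univ]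
    have : ∀ n : ℕ, (r ^ (n + 1) • convPow ν n) univ = r * (r * m) ^ n := fun n => by
      rw [Measure.smul_apply, convPow_univ, smul_eq_mul, pow_succ, mul_pow]
      ring
    simp_rw [this]
    rw [ENNReal.tsum_mul_left, ENNReal.tsum_geometric,
      show 1 - r * m = r from ENNReal.sub_eq_of_eq_add hrm_top hrm.symm,
      ENNReal.mul_inv_cancel hr0 hr_top]
  have hprob : IsProbabilityMeasure μ := ⟨huniv⟩
  refine ⟨μ, hprob, ?_, fun s => ?_⟩
  · rw [hμ, Measure.sum_apply _ measurableSet_Iio, ENNReal.tsum_eq_zero]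
    intro n
    rw [Measure.smul_apply, convPow_Iio_zero hν, smul_zero]
  · have hR : r.toReal = (1 + ν.real univ)⁻¹ := by
      rw [hr, ENNReal.toReal_inv, ENNReal.toReal_add ENNReal.one_ne_top hm_top,
        ENNReal.toReal_one, Measure.real]
    have hM : 0 ≤ ν.real univ := measureReal_nonneg
    rw [charFun_apply_real, hμ, integral_sum_measure (by rw [← hμ]; exact integrable_exp_mul_I μ s)]
    have hterm : ∀ n : ℕ, ∫ x, Complex.exp (s * x * Complex.I) ∂(r ^ (n + 1) • convPow ν n) =
        (r.toReal : ℂ) * ((r.toReal : ℂ) * charFun ν s) ^ n := fun n => by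
      rw [integral_smul_measure, ← charFun_apply_real, charFun_convPow, ENNReal.toReal_pow,
        Complex.real_smul]
      push_cast
      ring
    simp_rw [hterm]
    have hlt : ‖(r.toReal : ℂ) * charFun ν s‖ < 1 := by
      rw [norm_mul, Complex.norm_real, Real.norm_of_nonneg ENNReal.toReal_nonneg, hR,
        inv_mul_lt_iff₀ (by linarith)]
      have := norm_charFun_le (μ := ν) s
      linarith
    rw [tsum_mul_left, tsum_geometric_of_norm_lt_one hlt, hR]
    have h0 : (1 + (ν.real univ : ℂ)) ≠ 0 := by
      have : (1 + ν.real univ) ≠ 0 := by linarith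
      exact_mod_cast this
    push_cast
    rw [← mul_inv, mul_sub, mul_inv_cancel_left₀ h0, mul_one]

/-- The truncation of the Lévy measure `α x^{-α-1} dx` of `(0, 1)` to `(ε, 1)`. -/
def truncatedLevy (α ε : ℝ) : Measure ℝ :=
  (volume.restrict (Ioc ε 1)).withDensity fun x => ENNReal.ofReal (α * x ^ (-α - 1))

lemma integrableOn_levy {ε : ℝ} (hε : 0 < ε) :
    IntegrableOn (fun x : ℝ => α * x ^ (-α - 1)) (Ioc ε 1) := by
  refine Integrable.const_mul ?_ _
  refine IntegrableOn.mono_set (ContinuousOn.integrableOn_Icc fun x hx => ?_) Ioc_subset_Icc_self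
  exact (Real.continuousAt_rpow_const _ _ (Or.inl (hε.trans_le hx.1).ne')).continuousWithinAt

lemma isFiniteMeasure_truncatedLevy {ε : ℝ} (hε : 0 < ε) :
    IsFiniteMeasure (truncatedLevy α ε) :=
  isFiniteMeasure_withDensity_ofReal (integrableOn_levy hε).2

lemma integral_truncatedLevy (hα₀ : 0 < α) {ε : ℝ} (hε : 0 < ε) (f : ℝ → ℂ) :
    ∫ x, f x ∂(truncatedLevy α ε) = ∫ x in Ioc ε 1, ((α * x ^ (-α - 1) : ℝ) : ℂ) * f x := by
  rw [truncatedLevy, integral_withDensity_eq_integral_toReal_smul (by fun_prop) (by simp)]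
  refine setIntegral_congr_fun measurableSet_Ioc fun x hx => ?_
  have hx0 : 0 < x := hε.trans hx.1
  rw [ENNReal.toReal_ofReal (by positivity), Complex.real_smul]

lemma one_add_truncatedLevy_sub (hα₀ : 0 < α) {ε : ℝ} (hε : 0 < ε) (s : ℝ) :
    1 + (truncatedLevy α ε).real univ - charFun (truncatedLevy α ε) s =
      1 - α * ∫ x in Ioc ε 1, (Complex.exp (Complex.I * s * x) - 1) * ((x ^ (-α - 1) : ℝ) : ℂ) := by
  have := isFiniteMeasure_truncatedLevy (α := α) hε
  rw [← charFun_zero, add_sub_assoc, charFun_apply_real, charFun_apply_real, ← integral_sub]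
  · rw [integral_truncatedLevy hα₀ hε, sub_eq_add_neg (1 : ℂ), ← integral_const_mul, ← integral_neg]
    congr 1
    refine integral_congr_ae (ae_of_all _ fun x => ?_)
    simp only [Complex.ofReal_zero, zero_mul, Complex.exp_zero]
    rw [show Complex.I * s * x = s * x * Complex.I by ring]
    push_cast
    ring
  all_goals exact integrable_exp_mul_I _ _

lemma continuous_phi (hα₀ : 0 < α) (hα₁ : α < 1) : Continuous (phi α) :=
  continuous_iff_continuousAt.2 fun s => (hasDerivAt_phi hα₀ hα₁ s).continuousAt

/-- Existence of the Darling–Mandelbrot law, as a weak limit of compound geometric laws. -/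
theorem exists_isLaw (hα₀ : 0 < α) (hα₁ : α < 1) :
    ∃ μ : Measure ℝ, IsLaw α μ ∧ μ (Iio 0) = 0 := by
  set ε : ℕ → ℝ := fun n => 1 / ((n : ℝ) + 1)
  have hε : ∀ n, 0 < ε n := fun n => Nat.one_div_pos_of_nat
  have hex : ∀ n, ∃ μ : Measure ℝ, IsProbabilityMeasure μ ∧ μ (Iio 0) = 0 ∧
      ∀ s, charFun μ s = (1 - α * ∫ x in Ioc (ε n) 1,
        (Complex.exp (Complex.I * s * x) - 1) * ((x ^ (-α - 1) : ℝ) : ℂ))⁻¹ := by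
    intro n
    have := isFiniteMeasure_truncatedLevy (α := α) (hε n)
    have h0 : truncatedLevy α (ε n) (Iio 0) = 0 := by
      refine withDensity_absolutelyContinuous _ _ ?_
      rw [Measure.restrict_apply measurableSet_Iio]
      have : Iio (0 : ℝ) ∩ Ioc (ε n) 1 = ∅ := by
        ext x
        simp only [mem_inter_iff, mem_Iio, mem_Ioc, mem_empty_iff_false, iff_false]
        intro h
        linarith [hε n, h.1, h.2.1]
      rw [this, measure_empty]
    obtain ⟨μ, h1, h2, h3⟩ := exists_compound_geometric _ h0
    exact ⟨μ, h1, h2, fun s => by rw [h3, one_add_truncatedLevy_sub hα₀ (hε n)]⟩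
  choose μ hprob hμ0 hμ using hex
  have hU : ⋃ n, Ioc (ε n) 1 = Ioc (0 : ℝ) 1 := by
    ext x
    simp only [mem_iUnion, mem_Ioc]
    constructor
    · rintro ⟨n, h1, h2⟩
      exact ⟨(hε n).trans h1, h2⟩
    · rintro ⟨h1, h2⟩
      obtain ⟨n, hn⟩ := exists_nat_one_div_lt h1
      exact ⟨n, hn, h2⟩
  have hlim : ∀ s, Tendsto (fun n => charFun (μ n) s) atTop (𝓝 (phi α s)) := by
    intro s
    simp_rw [hμ, phi_eq_inv_psi]
    refine Tendsto.inv₀ ?_ (psi_ne_zero hα₀ hα₁ s)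
    rw [psi_eq_integral hα₁, ← hU]
    refine tendsto_const_nhds.sub (Tendsto.const_mul _ ?_)
    refine tendsto_setIntegral_of_monotone (fun n => measurableSet_Ioc) ?_ ?_
    · intro m n hmn
      exact Ioc_subset_Ioc_left (one_div_le_one_div_of_le (by positivity)
        (by have : (m : ℝ) ≤ n := by exact_mod_cast hmn
            linarith))
    · rw [hU]
      exact integrableOn_exp_sub_one hα₁ s
  -- Pointwise convergence of characteristic functions to a limit continuous at 0 forces tightness.
  have htight : IsTightMeasureSet (range μ) :=
    isTightMeasureSet_of_tendsto_charFun (continuous_phi hα₀ hα₁).continuousAt hlim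
  let P : ℕ → ProbabilityMeasure ℝ := fun n => ⟨μ n, hprob n⟩
  have hcomp : IsCompact (closure (range P)) := by
    refine isCompact_closure_of_isTightMeasureSet ?_
    convert htight using 1
    ext m
    constructor
    · rintro ⟨_, ⟨n, rfl⟩, rfl⟩
      exact ⟨n, rfl⟩
    · rintro ⟨n, rfl⟩
      exact ⟨_, ⟨n, rfl⟩, rfl⟩
  -- A limit along an ultrafilter suffices, since the characteristic functions converge along the
  -- whole sequence.
  obtain ⟨U, hUle⟩ := Ultrafilter.exists_le (atTop : Filter ℕ)
  obtain ⟨Q, -, hQ : Tendsto P U (𝓝 Q)⟩ := hcomp.ultrafilter_le_nhds (U.map P)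
    (le_principal_iff.2 (Filter.mem_of_superset (Filter.image_mem_map Filter.univ_mem)
      (by rw [image_univ]; exact subset_closure)))
  refine ⟨Q, ⟨inferInstance, fun s => ?_⟩, ?_⟩
  · have h := hQ
    rw [ProbabilityMeasure.tendsto_iff_forall_integral_rclike_tendsto ℂ] at h
    have h' := h (BoundedContinuousFunction.innerProbChar s)
    simp_rw [← charFun_eq_integral_innerProbChar] at h'
    exact tendsto_nhds_unique h' ((hlim s).mono_left hUle)
  -- Portmanteau: the negative half-line is open, so its null mass passes to the limit.
  · have h := ProbabilityMeasure.le_liminf_measure_open_of_tendsto hQ (isOpen_Iio (a := (0 : ℝ)))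
    have : (fun n => (P n : Measure ℝ) (Iio 0)) = fun _ => 0 := funext hμ0
    rw [this] at h
    simpa using h

end

/-! ### Finite moments and the size-biased law -/

section

variable {α : ℝ}

lemma norm_psi_sub_one_le (hα₀ : 0 < α) (hα₁ : α < 1) (s : ℝ) :
    ‖psi α (Complex.I * s) - 1‖ ≤ α * (|s| * (1 / (1 - α))) := by
  rw [psi_eq_integral hα₁, sub_sub_cancel_left, norm_neg, norm_mul, Complex.norm_real,
    Real.norm_of_nonneg hα₀.le]
  gcongr
  have hval : ∫ x in Ioc (0 : ℝ) 1, |s| * x ^ (-α) = |s| * (1 / (1 - α)) := by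
    rw [integral_const_mul, ← intervalIntegral.integral_of_le zero_le_one,
      integral_rpow (Or.inl (by linarith)), Real.one_rpow, Real.zero_rpow (by linarith), sub_zero]
    ring_nf
  rw [← hval]
  refine norm_integral_le_of_norm_le (((intervalIntegrable_iff_integrableOn_Ioc_of_le
    zero_le_one).1 (intervalIntegral.intervalIntegrable_rpow' (by linarith))).const_mul _) ?_
  filter_upwards [ae_restrict_mem measurableSet_Ioc] with x hx
  exact norm_exp_sub_one_mul_rpow_le s hx.1

lemma re_psi_sub_one_le (hα₀ : 0 < α) (hα₁ : α < 1) (s : ℝ) :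
    (psi α (Complex.I * s)).re - 1 ≤ α * s ^ 2 := by
  rw [psi_eq_integral hα₁, Complex.sub_re, Complex.one_re, Complex.re_ofReal_mul,
    sub_sub_cancel_left, ← mul_neg]
  gcongr
  have hi := (integrableOn_exp_sub_one hα₁ s).integrable
  have := integral_re (𝕜 := ℂ) hi
  simp only [RCLike.re_to_complex] at this
  rw [← this, ← integral_neg]
  calc _ ≤ ∫ x in Ioc (0 : ℝ) 1, s ^ 2 := by
        refine setIntegral_mono_on hi.re.neg (integrable_const _) measurableSet_Ioc fun x hx => ?_
        rw [mul_comm, Complex.re_ofReal_mul, ← mul_neg, Complex.sub_re, Complex.one_re,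
          show Complex.I * s * x = ((s * x : ℝ) : ℂ) * Complex.I by push_cast; ring,
          Complex.exp_ofReal_mul_I_re]
        have hc := Real.one_sub_sq_div_two_le_cos (x := s * x)
        -- The factor `x²` from `1 - cos(sx)` absorbs the singularity, because `α < 1` and `x ≤ 1`.
        have h1 : x ^ (-α - 1) ≤ x ^ (-2 : ℝ) :=
          Real.rpow_le_rpow_of_exponent_ge hx.1 hx.2 (by linarith)
        have hx2 : x ^ (-2 : ℝ) * x ^ 2 = 1 := by
          rw [← Real.rpow_natCast x 2, ← Real.rpow_add hx.1]
          norm_num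
        have h0 := Real.rpow_nonneg hx.1.le (-2)
        calc x ^ (-α - 1) * -(Real.cos (s * x) - 1) ≤ x ^ (-2 : ℝ) * (s * x) ^ 2 := by
              refine mul_le_mul h1 (by nlinarith [sq_nonneg (s * x)]) ?_ h0
              linarith [Real.cos_le_one (s * x)]
          _ = s ^ 2 := by rw [mul_pow, mul_left_comm, hx2, mul_one]
    _ = s ^ 2 := by simp

/-- For `Re w ≥ 1` one has `1 - Re(1/w) ≤ (Re w - 1) + (Im w)²`, and for `w = ψ(is)` both terms are
`O(s²)`. -/
lemma one_sub_re_phi_le (hα₀ : 0 < α) (hα₁ : α < 1) (s : ℝ) :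
    1 - (phi α s).re ≤ (α + (α * (1 / (1 - α))) ^ 2) * s ^ 2 := by
  set w := psi α (Complex.I * s) with hw
  have h1 : 1 ≤ w.re := one_le_re_psi hα₀ hα₁ s
  have h2 : w.re - 1 ≤ α * s ^ 2 := re_psi_sub_one_le hα₀ hα₁ s
  have h3 : w.im ^ 2 ≤ (α * (1 / (1 - α))) ^ 2 * s ^ 2 := by
    have h4 : |w.im| ≤ α * (|s| * (1 / (1 - α))) := by
      have := Complex.abs_im_le_norm (w - 1)
      rw [Complex.sub_im, Complex.one_im, sub_zero] at this
      exact this.trans (norm_psi_sub_one_le hα₀ hα₁ s)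
    calc w.im ^ 2 = |w.im| ^ 2 := (sq_abs _).symm
      _ ≤ (α * (|s| * (1 / (1 - α)))) ^ 2 := by gcongr
      _ = _ := by rw [← sq_abs s]; ring
  rw [phi_eq_inv_psi, ← hw, Complex.inv_re, Complex.normSq_apply]
  have hpos : 1 ≤ w.re * w.re + w.im * w.im := by nlinarith [sq_nonneg w.im]
  rw [← sub_nonneg]
  have h5 : 1 - w.re / (w.re * w.re + w.im * w.im) ≤ (w.re - 1) + w.im ^ 2 := by
    rw [sub_le_iff_le_add, ← sub_le_iff_le_add', le_div_iff₀ (by linarith)]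
    nlinarith [mul_nonneg (sub_nonneg.2 h1) (sub_nonneg.2 hpos), sq_nonneg w.im,
      mul_nonneg (sq_nonneg w.im) (sub_nonneg.2 hpos)]
  linarith

/-- A probability measure with `1 - Re φ(s) = O(s²)` is integrable. -/
lemma integrable_id_of_one_sub_re_charFun_le {μ : Measure ℝ} [IsProbabilityMeasure μ] {C : ℝ}
    (h : ∀ s, 1 - (charFun μ s).re ≤ C * s ^ 2) : Integrable (fun x : ℝ => x) μ := by
  have hcos : ∀ s : ℝ, Integrable (fun x : ℝ => 1 - Real.cos (s * x)) μ := fun s => by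
    refine (integrable_const (2 : ℝ)).mono' (Measurable.aestronglyMeasurable (by fun_prop)) ?_
    refine ae_of_all _ fun x => ?_
    rw [Real.norm_eq_abs, abs_le]
    constructor <;> linarith [Real.cos_le_one (s * x), Real.neg_one_le_cos (s * x)]
  have hval : ∀ s : ℝ, ∫ x, (1 - Real.cos (s * x)) ∂μ = 1 - (charFun μ s).re := fun s => by
    have h1 := integral_re (𝕜 := ℂ) (integrable_exp_mul_I μ s)
    simp only [RCLike.re_to_complex] at h1
    have h2 : ∀ x : ℝ, (Complex.exp (s * x * Complex.I)).re = Real.cos (s * x) := fun x => by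
      rw [← Complex.ofReal_mul, Complex.exp_ofReal_mul_I_re]
    simp_rw [h2] at h1
    rw [charFun_apply_real, ← h1, integral_sub (integrable_const _)]
    · simp
    · have := (integrable_exp_mul_I μ s).re
      simpa only [RCLike.re_to_complex, h2] using this
  -- Fatou at `s = 1/(n+1)`: the integrands `(n+1)² (1 - cos(x/(n+1)))` have integral at most `C`
  -- and exceed `2x²/π²` as soon as `|x| ≤ π(n+1)`.
  have hbound : ∫⁻ x, ENNReal.ofReal (2 / Real.pi ^ 2 * x ^ 2) ∂μ ≤ ENNReal.ofReal C := by
    calc _ ≤ ∫⁻ x, liminf (fun n : ℕ => ENNReal.ofReal (((n : ℝ) + 1) ^ 2 *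
            (1 - Real.cos (1 / ((n : ℝ) + 1) * x)))) atTop ∂μ := by
          refine lintegral_mono fun x => ?_
          refine le_liminf_of_le (by isBoundedDefault) ?_
          obtain ⟨N, hN⟩ := exists_nat_ge (|x| / Real.pi)
          filter_upwards [eventually_ge_atTop N] with n hn
          refine ENNReal.ofReal_le_ofReal ?_
          have hn' : |x| / Real.pi ≤ (n : ℝ) + 1 := by
            have : (N : ℝ) ≤ n := by exact_mod_cast hn
            linarith
          have hpos : (0 : ℝ) < (n : ℝ) + 1 := by positivity
          have habs : |1 / ((n : ℝ) + 1) * x| ≤ Real.pi := by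
            rw [abs_mul, abs_of_pos (by positivity), one_div_mul_eq_div, div_le_iff₀ hpos, mul_comm]
            exact (div_le_iff₀ Real.pi_pos).1 hn'
          have := Real.cos_le_one_sub_mul_cos_sq habs
          calc 2 / Real.pi ^ 2 * x ^ 2 = ((n : ℝ) + 1) ^ 2 *
                (2 / Real.pi ^ 2 * (1 / ((n : ℝ) + 1) * x) ^ 2) := by field_simp
            _ ≤ _ := by gcongr; linarith
      _ ≤ liminf (fun n : ℕ => ∫⁻ x, ENNReal.ofReal (((n : ℝ) + 1) ^ 2 *
            (1 - Real.cos (1 / ((n : ℝ) + 1) * x))) ∂μ) atTop :=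
          lintegral_liminf_le fun n => by fun_prop
      _ ≤ liminf (fun _ : ℕ => ENNReal.ofReal C) atTop := by
          refine liminf_le_liminf (Eventually.of_forall fun n => ?_)
          rw [← ofReal_integral_eq_lintegral_ofReal ((hcos _).const_mul _)]
          · refine ENNReal.ofReal_le_ofReal ?_
            rw [integral_const_mul, hval]
            calc _ ≤ ((n : ℝ) + 1) ^ 2 * (C * (1 / ((n : ℝ) + 1)) ^ 2) := by gcongr; exact h _
              _ = C := by field_simp
          · refine ae_of_all _ fun x => ?_
            have := Real.cos_le_one (1 / ((n : ℝ) + 1) * x)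
            exact mul_nonneg (by positivity) (by linarith)
      _ = ENNReal.ofReal C := liminf_const _
  have hsq : Integrable (fun x : ℝ => 2 / Real.pi ^ 2 * x ^ 2) μ := by
    refine ⟨Measurable.aestronglyMeasurable (by fun_prop), ?_⟩
    rw [hasFiniteIntegral_iff_ofReal (ae_of_all _ fun x => by positivity)]
    exact hbound.trans_lt ENNReal.ofReal_lt_top
  have hsq' : Integrable (fun x : ℝ => 1 + x ^ 2) μ := by
    refine (integrable_const _).add ((hsq.const_mul (Real.pi ^ 2 / 2)).congr (ae_of_all _ fun x => ?_))
    have := Real.pi_pos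
    simp only
    field_simp
  refine hsq'.mono' measurable_id.aestronglyMeasurable (ae_of_all _ fun x => ?_)
  rw [Real.norm_eq_abs]
  nlinarith [sq_abs x, sq_nonneg (|x| - 1)]

lemma IsLaw.integrable_id {μ : Measure ℝ} (hα₀ : 0 < α) (hα₁ : α < 1) (hμ : IsLaw α μ) :
    Integrable (fun x : ℝ => x) μ :=
  have := hμ.isProbabilityMeasure
  integrable_id_of_one_sub_re_charFun_le fun s => by
    rw [hμ.charFun_eq]
    exact one_sub_re_phi_le hα₀ hα₁ s

/-- Differentiation of the characteristic function under the integral, allowed by the finite first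
moment, compared with `φ' = iαKφ²`. -/
lemma IsLaw.integral_mul_exp {μ : Measure ℝ} (hα₀ : 0 < α) (hα₁ : α < 1) (hμ : IsLaw α μ) (s : ℝ) :
    ∫ x : ℝ, (x : ℂ) * Complex.exp (s * x * Complex.I) ∂μ =
      α * kernelTransform α (Complex.I * s) * phi α s ^ 2 := by
  have := hμ.isProbabilityMeasure
  have h1 : MemLp id ((1 : ℕ) : ENNReal) μ := by
    rw [Nat.cast_one, memLp_one_iff_integrable]
    exact hμ.integrable_id hα₀ hα₁
  have h2 := iteratedDeriv_charFun (t := s) h1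
  rw [iteratedDeriv_one, funext hμ.charFun_eq, (hasDerivAt_phi hα₀ hα₁ s).deriv, pow_one] at h2
  simp only [pow_one] at h2
  exact (mul_left_cancel₀ Complex.I_ne_zero h2).symm

/-- The function `x^{-α}` on `(0, 1]`, extended by zero. -/
def kernelDensity (α x : ℝ) : ENNReal :=
  (Ioc (0 : ℝ) 1).indicator (fun x => ENNReal.ofReal (x ^ (-α))) x

lemma measurable_kernelDensity (α : ℝ) : Measurable (kernelDensity α) :=
  Measurable.indicator (by fun_prop) measurableSet_Ioc

lemma withDensity_kernelDensity (α : ℝ) : volume.withDensity (kernelDensity α) =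
    (volume.restrict (Ioc 0 1)).withDensity fun x => ENNReal.ofReal (x ^ (-α)) :=
  withDensity_indicator measurableSet_Ioc _

lemma isFiniteMeasure_kernel (hα₁ : α < 1) :
    IsFiniteMeasure (volume.withDensity (kernelDensity α)) := by
  rw [withDensity_kernelDensity]
  exact isFiniteMeasure_withDensity_ofReal ((intervalIntegrable_iff_integrableOn_Ioc_of_le
    zero_le_one).1 (intervalIntegral.intervalIntegrable_rpow' (by linarith))).2

lemma charFun_kernel (hα₁ : α < 1) (s : ℝ) :
    charFun (volume.withDensity (kernelDensity α)) s = kernelTransform α (Complex.I * s) := by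
  rw [withDensity_kernelDensity, charFun_apply_real,
    integral_withDensity_eq_integral_toReal_smul (by fun_prop) (by simp),
    ← integral_rpow_mul_exp hα₁]
  refine setIntegral_congr_fun measurableSet_Ioc fun x hx => ?_
  rw [ENNReal.toReal_ofReal (Real.rpow_nonneg hx.1.le _), Complex.real_smul,
    show Complex.I * s * x = s * x * Complex.I by ring]

lemma ae_nonneg_of_Iio_zero {μ : Measure ℝ} (h0 : μ (Iio 0) = 0) : ∀ᵐ x ∂μ, 0 ≤ x := by
  rw [ae_iff]
  simp only [not_le]
  exact h0

/-- The size-biased law is `α` times the convolution of the kernel with the law twice. -/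
lemma IsLaw.withDensity_id_eq {μ : Measure ℝ} (hα₀ : 0 < α) (hα₁ : α < 1) (hμ : IsLaw α μ)
    (h0 : μ (Iio 0) = 0) :
    μ.withDensity (fun x => ENNReal.ofReal x) =
      ENNReal.ofReal α • ((volume.withDensity (kernelDensity α) ∗ μ) ∗ μ) := by
  have := hμ.isProbabilityMeasure
  have := isFiniteMeasure_kernel hα₁
  have : IsFiniteMeasure (μ.withDensity fun x => ENNReal.ofReal x) :=
    isFiniteMeasure_withDensity_ofReal (hμ.integrable_id hα₀ hα₁).2
  have : IsFiniteMeasure (ENNReal.ofReal α • ((volume.withDensity (kernelDensity α) ∗ μ) ∗ μ)) :=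
    Measure.smul_finite _ ENNReal.ofReal_ne_top
  refine Measure.ext_of_charFun (funext fun s => ?_)
  have h1 : charFun (ENNReal.ofReal α • ((volume.withDensity (kernelDensity α) ∗ μ) ∗ μ)) s =
      α * charFun ((volume.withDensity (kernelDensity α) ∗ μ) ∗ μ) s := by
    rw [charFun_apply_real, integral_smul_measure, ← charFun_apply_real,
      ENNReal.toReal_ofReal hα₀.le, Complex.real_smul]
  rw [h1, charFun_conv, charFun_conv, charFun_kernel hα₁, hμ.charFun_eq, charFun_apply_real,
    integral_withDensity_eq_integral_toReal_smul (by fun_prop) (by simp)]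
  rw [mul_assoc, ← pow_two, ← mul_assoc, ← hμ.integral_mul_exp hα₀ hα₁]
  refine integral_congr_ae ?_
  filter_upwards [ae_nonneg_of_Iio_zero h0] with x hx
  rw [ENNReal.toReal_ofReal hx, Complex.real_smul]

end

/-! ### The kernel convolved with the law is a shifted tail -/

section

variable {α : ℝ} {μ : Measure ℝ}

lemma withDensity_conv (f : ℝ → ENNReal) (hf : Measurable f) (μ : Measure ℝ) [SFinite μ] :
    volume.withDensity f ∗ μ = volume.withDensity fun x => ∫⁻ y, f (x - y) ∂μ := by
  have hm : Measurable fun x : ℝ => ∫⁻ y, f (x - y) ∂μ :=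
    Measurable.lintegral_prod_right' (f := fun p : ℝ × ℝ => f (p.1 - p.2)) (by fun_prop)
  refine Measure.ext_of_lintegral _ fun φ hφ => ?_
  rw [Measure.lintegral_conv hφ, lintegral_withDensity_eq_lintegral_mul _ hf
    (Measurable.lintegral_prod_right' (f := fun p : ℝ × ℝ => φ (p.1 + p.2)) (by fun_prop)),
    lintegral_withDensity_eq_lintegral_mul _ hm hφ]
  simp only [Pi.mul_apply]
  have h1 : ∀ x, f x * ∫⁻ y, φ (x + y) ∂μ = ∫⁻ y, f x * φ (x + y) ∂μ := fun x =>
    (lintegral_const_mul _ (by fun_prop)).symm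
  have h2 : ∀ x, (∫⁻ y, f (x - y) ∂μ) * φ x = ∫⁻ y, f (x - y) * φ x ∂μ := fun x =>
    (lintegral_mul_const _ (by fun_prop)).symm
  simp_rw [h1, h2]
  refine (lintegral_lintegral_swap (by fun_prop)).trans
    (Eq.trans (lintegral_congr fun y => ?_) (lintegral_lintegral_swap (by fun_prop)).symm)
  have h3 := lintegral_add_right_eq_self (μ := (volume : Measure ℝ))
    (fun x => f (x - y) * φ x) y
  simpa using h3

/-- The function `x ↦ P(X > x - 1)` on the positive half-line. -/
def tailDensity (μ : Measure ℝ) (x : ℝ) : ENNReal :=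
  (Ioi (0 : ℝ)).indicator (fun x => μ (Ioi (x - 1))) x

lemma measurable_tailDensity (μ : Measure ℝ) : Measurable (tailDensity μ) := by
  refine Measurable.indicator (Antitone.measurable fun a b hab => ?_) measurableSet_Ioi
  exact measure_mono (Ioi_subset_Ioi (by linarith))

lemma tailDensity_le_one [IsProbabilityMeasure μ] (x : ℝ) : tailDensity μ x ≤ 1 := by
  unfold tailDensity
  by_cases hx : x ∈ Ioi (0 : ℝ)
  · rw [indicator_of_mem hx]
    exact prob_le_one
  · rw [indicator_of_notMem hx]
    exact zero_le_one

/-- The region `0 < x < a + 1`. -/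
def tailRegion : Set (ℝ × ℝ) := {p | 0 < p.2 ∧ p.2 < p.1 + 1}

lemma measurableSet_tailRegion : MeasurableSet tailRegion :=
  (measurableSet_lt measurable_const measurable_snd).inter
    (measurableSet_lt measurable_snd (measurable_fst.add_const 1))

lemma prod_tailRegion_lt_top [IsProbabilityMeasure μ] (hint : Integrable (fun x : ℝ => x) μ) :
    (μ.prod volume) tailRegion < ⊤ := by
  rw [Measure.prod_apply measurableSet_tailRegion]
  have h : ∀ a : ℝ, volume (Prod.mk a ⁻¹' tailRegion) = ENNReal.ofReal (a + 1) := fun a => by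
    have : Prod.mk a ⁻¹' tailRegion = Ioo 0 (a + 1) := rfl
    rw [this, Real.volume_Ioo, sub_zero]
  simp_rw [h]
  exact (isFiniteMeasure_withDensity_ofReal (hint.add (integrable_const (1 : ℝ))).2
    |>.measure_univ_lt_top).trans_eq' (by rw [withDensity_apply _ MeasurableSet.univ, setLIntegral_univ]; rfl)

/-- By Tonelli the total mass is the `μ ⊗ dx` measure of `tailRegion`, which the first moment
bounds. -/
lemma isFiniteMeasure_tail [IsProbabilityMeasure μ] (hint : Integrable (fun x : ℝ => x) μ) :
    IsFiniteMeasure (volume.withDensity (tailDensity μ)) := by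
  refine isFiniteMeasure_withDensity ?_
  refine ne_of_lt ((prod_tailRegion_lt_top hint).trans_eq' ?_)
  rw [Measure.prod_apply_symm measurableSet_tailRegion]
  refine lintegral_congr fun x => ?_
  unfold tailDensity
  by_cases hx : x ∈ Ioi (0 : ℝ)
  · rw [indicator_of_mem hx]
    congr 1
    ext a
    simp only [mem_Ioi] at hx
    simp [tailRegion, hx, sub_lt_iff_lt_add]
  · rw [indicator_of_notMem hx]
    have : (fun a => (a, x)) ⁻¹' tailRegion = ∅ := by
      ext a
      simp only [mem_Ioi] at hx
      simp [tailRegion, hx]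
    rw [this, measure_empty]

/-- Fubini for `e^{isx}` on `0 < x < a + 1`: integrating over `a` first gives the tail, integrating
over `x` first gives `(e^{is(a+1)} - 1)/(is)`. -/
lemma charFun_tail [IsProbabilityMeasure μ] (hint : Integrable (fun x : ℝ => x) μ)
    (h0 : μ (Iio 0) = 0) {s : ℝ} (hs : s ≠ 0) :
    charFun (volume.withDensity (tailDensity μ)) s =
      (Complex.exp (s * Complex.I) * charFun μ s - 1) / (s * Complex.I) := by
  have hc : (s : ℂ) * Complex.I ≠ 0 :=
    mul_ne_zero (by exact_mod_cast hs) Complex.I_ne_zero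
  set F : ℝ × ℝ → ℂ := tailRegion.indicator fun p => Complex.exp (s * p.2 * Complex.I) with hF
  have hFint : Integrable F (μ.prod volume) := by
    rw [hF, integrable_indicator_iff measurableSet_tailRegion]
    refine (integrableOn_const (prod_tailRegion_lt_top hint).ne (C := (1 : ℝ))).mono'
      (Measurable.aestronglyMeasurable (by fun_prop)) (ae_of_all _ fun p => ?_)
    rw [← Complex.ofReal_mul, Complex.norm_exp_ofReal_mul_I]
  have hswap := (integral_prod F hFint).symm.trans (integral_prod_symm F hFint)
  have hright : ∀ x : ℝ, ∫ a, F (a, x) ∂μ =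
      (tailDensity μ x).toReal • Complex.exp (s * x * Complex.I) := fun x => by
    unfold tailDensity
    by_cases hx : x ∈ Ioi (0 : ℝ)
    · rw [indicator_of_mem hx]
      have : (fun a => F (a, x)) = (Ioi (x - 1)).indicator
          fun _ => Complex.exp (s * x * Complex.I) := by
        funext a
        simp only [mem_Ioi] at hx
        simp [hF, tailRegion, indicator, hx, sub_lt_iff_lt_add]
      rw [this, integral_indicator_const _ measurableSet_Ioi]
      rfl
    · rw [indicator_of_notMem hx]
      have : (fun a => F (a, x)) = fun _ => 0 := by
        funext a
        simp only [mem_Ioi] at hx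
        simp [hF, tailRegion, hx]
      rw [this]
      simp
  have hleft : ∀ᵐ a ∂μ, ∫ x, F (a, x) =
      (Complex.exp (s * Complex.I) * Complex.exp (s * a * Complex.I) - 1) / (s * Complex.I) := by
    filter_upwards [ae_nonneg_of_Iio_zero h0] with a ha
    have : (fun x => F (a, x)) = (Ioo 0 (a + 1)).indicator
        fun x : ℝ => Complex.exp (s * Complex.I * x) := by
      funext x
      simp only [hF, tailRegion, indicator, mem_ofPred_eq, mem_Ioo]
      rw [show (s : ℂ) * x * Complex.I = s * Complex.I * x by ring]
    rw [this, integral_indicator measurableSet_Ioo, ← integral_Ioc_eq_integral_Ioo,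
      ← intervalIntegral.integral_of_le (by linarith), integral_exp_mul_complex hc, ← Complex.exp_add]
    simp only [Complex.ofReal_zero, mul_zero, Complex.exp_zero]
    congr 3
    push_cast
    ring
  rw [charFun_apply_real, integral_withDensity_eq_integral_toReal_smul (measurable_tailDensity μ)
    (ae_of_all _ fun x => (tailDensity_le_one x).trans_lt ENNReal.one_lt_top)]
  simp_rw [← hright]
  rw [← hswap, integral_congr_ae hleft, integral_div, integral_sub
    ((integrable_exp_mul_I μ s).const_mul _) (integrable_const _), integral_const_mul,
    ← charFun_apply_real]
  simp

/-- This is `(e^z - zK)φ = 1` at `z = is`, solved for `Kφ`. The division excludes `s = 0`, which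
continuity restores. -/
lemma IsLaw.kernel_conv_eq (hα₀ : 0 < α) (hα₁ : α < 1) (hμ : IsLaw α μ) (h0 : μ (Iio 0) = 0) :
    volume.withDensity (kernelDensity α) ∗ μ = volume.withDensity (tailDensity μ) := by
  have := hμ.isProbabilityMeasure
  have := isFiniteMeasure_kernel hα₁
  have hint := hμ.integrable_id hα₀ hα₁
  have := isFiniteMeasure_tail hint
  refine Measure.ext_of_charFun (Continuous.ext_on (dense_compl_singleton (0 : ℝ))
    continuous_charFun continuous_charFun fun s hs => ?_)
  have hs : s ≠ 0 := hs
  have hc : (s : ℂ) * Complex.I ≠ 0 := mul_ne_zero (by exact_mod_cast hs) Complex.I_ne_zero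
  rw [charFun_tail hint h0 hs, charFun_conv, charFun_kernel hα₁, hμ.charFun_eq, eq_div_iff hc]
  have h1 := psi_eq_exp_sub hα₁ (Complex.I * s)
  have h2 : psi α (Complex.I * s) * phi α s = 1 := by
    rw [phi_eq_inv_psi, mul_inv_cancel₀ (psi_ne_zero hα₀ hα₁ s)]
  rw [h1] at h2
  rw [mul_comm (s : ℂ) Complex.I]
  linear_combination -h2

end

/-! ### The density and the integrated equation -/

section

variable {α : ℝ} {μ : Measure ℝ} {g : ℝ → ℝ}

lemma IsLaw.lintegral_kernelDensity (hα₀ : 0 < α) (hα₁ : α < 1) (hμ : IsLaw α μ)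
    (h0 : μ (Iio 0) = 0) :
    ∀ᵐ x, ∫⁻ y, kernelDensity α (x - y) ∂μ = tailDensity μ x := by
  have := hμ.isProbabilityMeasure
  have := isFiniteMeasure_kernel hα₁
  have h := hμ.kernel_conv_eq hα₀ hα₁ h0
  have hfin : IsFiniteMeasure (volume.withDensity (kernelDensity α) ∗ μ) := inferInstance
  rw [withDensity_conv _ (measurable_kernelDensity α)] at h hfin
  have hm : Measurable fun x : ℝ => ∫⁻ y, kernelDensity α (x - y) ∂μ :=
    Measurable.lintegral_prod_right' (f := fun p : ℝ × ℝ => kernelDensity α (p.1 - p.2))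
      ((measurable_kernelDensity α).comp (measurable_fst.sub measurable_snd))
  refine (withDensity_eq_iff hm.aemeasurable (measurable_tailDensity μ).aemeasurable ?_).1 h
  have := hfin.measure_univ_lt_top
  rw [withDensity_apply _ MeasurableSet.univ, setLIntegral_univ] at this
  exact this.ne

lemma exists_mem_Ioo_of_ae {p : ℝ → Prop} (h : ∀ᵐ x, p x) {a b : ℝ} (hab : a < b) :
    ∃ x ∈ Ioo a b, p x := by
  by_contra! hc
  have h1 : volume (Ioo a b) = 0 := measure_mono_null hc h
  rw [Real.volume_Ioo, ENNReal.ofReal_eq_zero] at h1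
  linarith

/-- An atom at 0 would make the density of `k * μ` at least `x^{-α} μ{0}`, unbounded near 0, whereas
a tail probability is at most 1. -/
lemma IsLaw.singleton_zero (hα₀ : 0 < α) (hα₁ : α < 1) (hμ : IsLaw α μ) (h0 : μ (Iio 0) = 0) :
    μ {0} = 0 := by
  have := hμ.isProbabilityMeasure
  by_contra hne
  have ha : 0 < μ.real {0} := ENNReal.toReal_pos hne (measure_ne_top _ _)
  have hev : ∀ᶠ x in 𝓝[>] (0 : ℝ), 1 < x ^ (-α) * μ.real {0} :=
    ((tendsto_rpow_neg_nhdsGT_zero (neg_neg_of_pos hα₀)).atTop_mul_const ha).eventually_gt_atTop 1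
  obtain ⟨δ, hδ, hδ'⟩ := mem_nhdsGT_iff_exists_Ioo_subset.1 hev
  have hδ : 0 < δ := hδ
  obtain ⟨x, hx, hxe⟩ := exists_mem_Ioo_of_ae (hμ.lintegral_kernelDensity hα₀ hα₁ h0)
    (lt_min hδ zero_lt_one)
  have hx1 : x ≤ 1 := hx.2.le.trans (min_le_right _ _)
  have hxδ : 1 < x ^ (-α) * μ.real {0} := hδ' ⟨hx.1, hx.2.trans_le (min_le_left _ _)⟩
  have hle : ENNReal.ofReal (x ^ (-α)) * μ {0} ≤ 1 := by
    calc _ = ∫⁻ y in {0}, kernelDensity α (x - y) ∂μ := by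
          rw [lintegral_singleton, sub_zero, kernelDensity, 
            indicator_of_mem (show x ∈ Ioc (0 : ℝ) 1 from ⟨hx.1, hx1⟩)]
      _ ≤ ∫⁻ y, kernelDensity α (x - y) ∂μ := setLIntegral_le_lintegral _ _
      _ ≤ 1 := hxe ▸ tailDensity_le_one x
  have := ENNReal.toReal_mono ENNReal.one_ne_top hle
  rw [ENNReal.toReal_mul, ENNReal.toReal_ofReal (Real.rpow_nonneg hx.1.le _),
    ENNReal.toReal_one] at this
  exact absurd hxδ (not_lt.2 this)

/-- The density of the convolution of the tail measure with the law. -/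
def tailConv (μ : Measure ℝ) (x : ℝ) : ENNReal := ∫⁻ y, tailDensity μ (x - y) ∂μ

lemma measurable_tailConv (μ : Measure ℝ) [SFinite μ] : Measurable (tailConv μ) :=
  Measurable.lintegral_prod_right' (f := fun p : ℝ × ℝ => tailDensity μ (p.1 - p.2))
    ((measurable_tailDensity μ).comp (measurable_fst.sub measurable_snd))

lemma tailConv_le_one [IsProbabilityMeasure μ] (x : ℝ) : tailConv μ x ≤ 1 :=
  (lintegral_mono fun _ => tailDensity_le_one _).trans (by simp)

/-- For `y < x` the events `X > x - y - 1` and `X ≤ x - 1 - y` are complementary; for `y ≥ x` both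
terms vanish by positivity of `X`. -/
lemma tailConv_add [IsProbabilityMeasure μ] (h0 : μ (Iio 0) = 0) (x : ℝ) :
    tailConv μ x + (μ ∗ μ) (Iic (x - 1)) = μ (Iio x) := by
  have h1 : (μ ∗ μ) (Iic (x - 1)) = ∫⁻ y, μ (Iic (x - 1 - y)) ∂μ := by
    rw [← lintegral_indicator_one measurableSet_Iic,
      Measure.lintegral_conv (measurable_one.indicator measurableSet_Iic)]
    refine lintegral_congr fun y => ?_
    rw [← lintegral_indicator_one measurableSet_Iic]
    refine lintegral_congr fun z => ?_
    simp [indicator, le_sub_iff_add_le']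
  have hm : Measurable fun y => tailDensity μ (x - y) :=
    (measurable_tailDensity μ).comp (measurable_const.sub measurable_id)
  rw [h1, tailConv, ← lintegral_add_left hm, ← lintegral_indicator_one measurableSet_Iio]
  refine lintegral_congr fun y => ?_
  by_cases hy : y < x
  · rw [tailDensity, indicator_of_mem (show x - y ∈ Ioi 0 from sub_pos.2 hy),
      indicator_of_mem (show y ∈ Iio x from hy), Pi.one_apply, ← compl_Iic,
      show x - y - 1 = x - 1 - y by ring, add_comm, prob_add_prob_compl measurableSet_Iic]
  · rw [tailDensity, indicator_of_notMem (show x - y ∉ Ioi 0 by simpa using hy),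
      indicator_of_notMem (show y ∉ Iio x from hy), zero_add]
    refine measure_mono_null (fun z hz => ?_) h0
    simp only [mem_Iic, mem_Iio] at hz ⊢
    linarith

/-- The size-biased measure has density `α tailConv`; having no atom at 0, `μ` is recovered from it
by dividing by `x`. -/
lemma IsLaw.eq_withDensity (hα₀ : 0 < α) (hα₁ : α < 1) (hμ : IsLaw α μ) (h0 : μ (Iio 0) = 0) :
    μ = volume.withDensity fun x => ENNReal.ofReal α * tailConv μ x * (ENNReal.ofReal x)⁻¹ := by
  have := hμ.isProbabilityMeasure
  have h1 := hμ.withDensity_id_eq hα₀ hα₁ h0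
  rw [hμ.kernel_conv_eq hα₀ hα₁ h0, withDensity_conv _ (measurable_tailDensity μ)] at h1
  change _ = ENNReal.ofReal α • volume.withDensity (tailConv μ) at h1
  have hpos : ∀ᵐ x ∂μ, ENNReal.ofReal x ≠ 0 := by
    have hIic : μ (Iic 0) = 0 := by
      rw [← Iio_union_right]
      exact measure_union_null h0 (hμ.singleton_zero hα₀ hα₁ h0)
    rw [ae_iff]
    simp only [ne_eq, not_not, ENNReal.ofReal_eq_zero]
    exact hIic
  conv_lhs => rw [← withDensity_inv_same ENNReal.measurable_ofReal hpos
    (ae_of_all _ fun _ => ENNReal.ofReal_ne_top), h1, ← withDensity_smul _ (measurable_tailConv μ)]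
  rw [← withDensity_mul _ ((measurable_tailConv μ).const_smul _) (by fun_prop)]
  rfl

/-- The density of a law, obtained from its size-biased version. -/
def lawDensity (α : ℝ) (μ : Measure ℝ) (x : ℝ) : ℝ :=
  if 0 < x then α * (tailConv μ x).toReal / x else 0

lemma lawDensity_nonneg (hα₀ : 0 < α) (x : ℝ) : 0 ≤ lawDensity α μ x := by
  unfold lawDensity
  split_ifs
  · positivity
  · exact le_rfl

lemma ofReal_lawDensity (hα₀ : 0 < α) [IsProbabilityMeasure μ] (h0 : μ (Iio 0) = 0) (x : ℝ) :
    ENNReal.ofReal (lawDensity α μ x) =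
      ENNReal.ofReal α * tailConv μ x * (ENNReal.ofReal x)⁻¹ := by
  unfold lawDensity
  split_ifs with hx
  · rw [ENNReal.ofReal_div_of_pos hx, ENNReal.ofReal_mul hα₀.le, ENNReal.ofReal_toReal
      ((tailConv_le_one x).trans_lt ENNReal.one_lt_top).ne, div_eq_mul_inv]
  -- Here `(ENNReal.ofReal x)⁻¹` is `⊤`, so the product vanishes only because `tailConv` does.
  · have h1 := tailConv_add h0 x
    rw [measure_mono_null (Iio_subset_Iio (not_lt.1 hx)) h0, add_eq_zero] at h1
    rw [h1.1, mul_zero, zero_mul, ENNReal.ofReal_zero]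

lemma IsLaw.withDensity_lawDensity (hα₀ : 0 < α) (hα₁ : α < 1) (hμ : IsLaw α μ)
    (h0 : μ (Iio 0) = 0) :
    volume.withDensity (fun x => ENNReal.ofReal (lawDensity α μ x)) = μ := by
  have := hμ.isProbabilityMeasure
  simp_rw [ofReal_lawDensity hα₀ h0]
  exact (hμ.eq_withDensity hα₀ hα₁ h0).symm

lemma measurable_lawDensity [SFinite μ] : Measurable (lawDensity α μ) := by
  refine Measurable.ite measurableSet_Ioi ?_ measurable_const
  exact ((measurable_tailConv μ).ennreal_toReal.const_mul α).div measurable_id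

/-- Integrable nonnegative functions on the half-line bounded by a multiple of `1 / x`. -/
structure IsTame (α : ℝ) (g : ℝ → ℝ) : Prop where
  nonneg : ∀ x, 0 ≤ g x
  eq_zero : ∀ x ≤ 0, g x = 0
  measurable : Measurable g
  integrable : Integrable g
  mul_le : ∀ x, 0 < x → g x ≤ α / x

lemma IsLaw.isTame_lawDensity (hα₀ : 0 < α) (hα₁ : α < 1) (hμ : IsLaw α μ) (h0 : μ (Iio 0) = 0) :
    IsTame α (lawDensity α μ) := by
  have := hμ.isProbabilityMeasure
  refine ⟨lawDensity_nonneg hα₀, fun x hx => if_neg (not_lt.2 hx), measurable_lawDensity, ?_, ?_⟩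
  · refine ⟨measurable_lawDensity.aestronglyMeasurable, ?_⟩
    rw [hasFiniteIntegral_iff_ofReal (ae_of_all _ (lawDensity_nonneg hα₀)), ← setLIntegral_univ,
      ← withDensity_apply _ MeasurableSet.univ, hμ.withDensity_lawDensity hα₀ hα₁ h0]
    exact measure_lt_top _ _
  · intro x hx
    have h1 : (tailConv μ x).toReal ≤ 1 :=
      ENNReal.toReal_mono ENNReal.one_ne_top (tailConv_le_one x)
    rw [lawDensity, if_pos hx]
    gcongr
    nlinarith

lemma conv_apply (f h : ℝ → ℝ) (x : ℝ) : conv f h x = ∫ y, f y * h (x - y) := rfl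

lemma conv_of_nonpos {f : ℝ → ℝ} (hf : ∀ x ≤ 0, f x = 0) {x : ℝ} (hx : x ≤ 0) :
    conv f f x = 0 := by
  rw [conv_apply]
  refine integral_eq_zero_of_ae (ae_of_all _ fun y => ?_)
  rcases le_total y 0 with hy | hy
  · simp [hf y hy]
  · simp [hf (x - y) (by linarith)]

/-- One of `y`, `x - y` is at least `x/2`, so one factor is at most `2α/x` and the other is
integrable. -/
lemma IsTame.integrable_mul (hg : IsTame α g) (x : ℝ) : Integrable fun y => g y * g (x - y) := by
  rcases le_or_gt x 0 with hx | hx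
  · refine (integrable_zero ℝ ℝ volume).congr (ae_of_all _ fun y => ?_)
    rcases le_total y 0 with hy | hy
    · simp [hg.eq_zero y hy]
    · simp [hg.eq_zero (x - y) (by linarith)]
  · have hb : Integrable fun y => (α / (x / 2)) * (g y + g (x - y)) :=
      (hg.integrable.add (hg.integrable.comp_sub_left x)).const_mul _
    refine hb.mono' (Measurable.aestronglyMeasurable (hg.measurable.mul
      (hg.measurable.comp (measurable_const.sub measurable_id)))) (ae_of_all _ fun y => ?_)
    have h1 := hg.nonneg y
    have h2 := hg.nonneg (x - y)
    have hα : 0 ≤ α / (x / 2) := (hg.nonneg (x / 2)).trans (hg.mul_le _ (by linarith))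
    have hα' : 0 ≤ α := by
      by_contra hc
      exact absurd hα (not_le.2 (div_neg_of_neg_of_pos (not_le.1 hc) (by linarith)))
    have key : ∀ z, x / 2 ≤ z → g z ≤ α / (x / 2) := fun z hz =>
      (hg.mul_le z (by linarith)).trans (div_le_div_of_nonneg_left hα' (by linarith) hz)
    rw [Real.norm_of_nonneg (mul_nonneg h1 h2)]
    rcases le_total (x / 2) y with hy | hy
    · nlinarith [key y hy]
    · nlinarith [key (x - y) (by linarith)]

lemma IsTame.convolutionExistsAt (hg : IsTame α g) (x : ℝ) :
    ConvolutionExistsAt g g x (ContinuousLinearMap.mul ℝ ℝ) volume :=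
  hg.integrable_mul x

lemma IsTame.conv_nonneg (hg : IsTame α g) (x : ℝ) : 0 ≤ conv g g x :=
  integral_nonneg fun y => mul_nonneg (hg.nonneg y) (hg.nonneg (x - y))

lemma IsTame.integrable_conv (hg : IsTame α g) : Integrable (conv g g) :=
  hg.integrable.integrable_convolution _ hg.integrable

lemma IsTame.withDensity_conv_withDensity (hg : IsTame α g) :
    (volume.withDensity fun x => ENNReal.ofReal (g x)) ∗
      (volume.withDensity fun x => ENNReal.ofReal (g x)) =
      volume.withDensity fun x => ENNReal.ofReal (conv g g x) := by
  rw [conv_withDensity_eq_lconvolution hg.measurable.ennreal_ofReal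
    hg.measurable.ennreal_ofReal]
  congr 1
  funext x
  rw [conv_apply, ofReal_integral_eq_lintegral_ofReal (hg.integrable_mul x)
    (ae_of_all _ fun y => mul_nonneg (hg.nonneg y) (hg.nonneg (x - y))), lconvolution]
  refine lintegral_congr fun y => ?_
  rw [ENNReal.ofReal_mul (hg.nonneg y), neg_add_eq_sub]

lemma measureReal_withDensity_ofReal {f : ℝ → ℝ} (hf : ∀ x, 0 ≤ f x) (hi : Integrable f)
    {s : Set ℝ} (hs : MeasurableSet s) :
    (volume.withDensity fun x => ENNReal.ofReal (f x)).real s = ∫ x in s, f x := by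
  rw [Measure.real, withDensity_apply _ hs, ← ofReal_integral_eq_lintegral_ofReal
    hi.integrableOn (ae_of_all _ hf), ENNReal.toReal_ofReal (integral_nonneg hf)]

/-- The integrated form of the equation. -/
lemma IsLaw.mul_lawDensity (hα₀ : 0 < α) (hα₁ : α < 1) (hμ : IsLaw α μ) (h0 : μ (Iio 0) = 0)
    {x : ℝ} (hx : 0 < x) :
    x * lawDensity α μ x = α * ((∫ y in Iic x, lawDensity α μ y) -
      ∫ y in Iic (x - 1), conv (lawDensity α μ) (lawDensity α μ) y) := by
  have := hμ.isProbabilityMeasure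
  have ht := hμ.isTame_lawDensity hα₀ hα₁ h0
  have h1 := measureReal_withDensity_ofReal ht.nonneg ht.integrable (measurableSet_Iio (a := x))
  have h2 := measureReal_withDensity_ofReal ht.conv_nonneg ht.integrable_conv
    (measurableSet_Iic (a := x - 1))
  rw [← ht.withDensity_conv_withDensity] at h2
  rw [hμ.withDensity_lawDensity hα₀ hα₁ h0] at h1 h2
  rw [integral_Iic_eq_integral_Iio, ← h1, ← h2]
  have h3 := congrArg ENNReal.toReal (tailConv_add h0 x)
  rw [ENNReal.toReal_add ((tailConv_le_one x).trans_lt ENNReal.one_lt_top).ne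
    (measure_ne_top _ _)] at h3
  rw [Measure.real, Measure.real, ← h3, add_sub_cancel_right, lawDensity, if_pos hx,
    mul_div_cancel₀ _ hx.ne']

end

/-! ### The differential equation, monotonicity and uniqueness -/

section

variable {α : ℝ} {μ : Measure ℝ} {f g h : ℝ → ℝ}

lemma setIntegral_Iic_eq (hf : Integrable f) (x : ℝ) :
    ∫ y in Iic x, f y = (∫ y in Iic 0, f y) + ∫ y in (0 : ℝ)..x, f y := by
  rw [← intervalIntegral.integral_Iic_sub_Iic hf.integrableOn hf.integrableOn, add_sub_cancel]

lemma continuous_setIntegral_Iic (hf : Integrable f) : Continuous fun x => ∫ y in Iic x, f y := by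
  rw [funext (setIntegral_Iic_eq hf)]
  exact continuous_const.add (hf.continuous_primitive 0)

lemma hasDerivAt_setIntegral_Iic (hf : Integrable f) {x : ℝ} (hx : ContinuousAt f x) :
    HasDerivAt (fun x => ∫ y in Iic x, f y) (f x) x := by
  rw [funext (setIntegral_Iic_eq hf)]
  exact (intervalIntegral.integral_hasDerivAt_right hf.intervalIntegrable
    (hf.aestronglyMeasurable.stronglyMeasurableAtFilter) hx).const_add _

/-- Folding at `x/2` keeps `x - y` away from 0, so that one dominating function serves for all
nearby `x`. -/
lemma IsTame.conv_eq_two_mul (hg : IsTame α g) (x : ℝ) :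
    conv g g x = 2 * ∫ y, (Iio (x / 2)).indicator (fun y => g y * g (x - y)) y := by
  have hi := hg.integrable_mul x
  have hsplit := integral_add_compl (measurableSet_Iio (a := x / 2)) hi
  rw [conv_apply, ← hsplit, compl_Iio, integral_Ici_eq_integral_Ioi, two_mul,
    integral_indicator measurableSet_Iio]
  congr 1
  rw [← integral_indicator measurableSet_Ioi, ← integral_indicator measurableSet_Iio,
    ← integral_sub_left_eq_self _ volume x]
  refine integral_congr_ae (ae_of_all _ fun y => ?_)
  have hiff : x - y ∈ Ioi (x / 2) ↔ y ∈ Iio (x / 2) := by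
    simp only [mem_Ioi, mem_Iio]
    constructor <;> intro <;> linarith
  by_cases hy : y ∈ Iio (x / 2)
  · simp only [indicator_of_mem hy, indicator_of_mem (hiff.2 hy), sub_sub_cancel]
    ring
  · simp only [indicator_of_notMem hy, indicator_of_notMem (mt hiff.1 hy)]

/-- The origin must be excluded: `g ~ C₀ x^{α-1}` gives `g * g` of order `x^{2α-1}`, discontinuous
at 0 when `α ≤ 1/2`. -/
lemma IsTame.continuousAt_conv (hg : IsTame α g) (hα₀ : 0 < α) (hc : ContinuousOn g (Ioi 0)) {x₀ : ℝ}
    (hx₀ : x₀ ≠ 0) : ContinuousAt (conv g g) x₀ := by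
  rcases lt_or_gt_of_ne hx₀ with hneg | hpos
  · have : conv g g =ᶠ[𝓝 x₀] fun _ => 0 := by
      filter_upwards [Iio_mem_nhds hneg] with x hx
      exact conv_of_nonpos hg.eq_zero (le_of_lt hx)
    exact continuousAt_const.congr this.symm
  · rw [funext hg.conv_eq_two_mul]
    refine ContinuousAt.const_mul ?_ 2 |>.congr (Eventually.of_forall fun _ => rfl)
    refine continuousAt_of_dominated (bound := fun y => α / (x₀ / 4) * g y) ?_ ?_
      (hg.integrable.const_mul _) ?_
    · refine Eventually.of_forall fun x => Measurable.aestronglyMeasurable ?_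
      exact (hg.measurable.mul (hg.measurable.comp (measurable_const.sub measurable_id))).indicator
        measurableSet_Iio
    · filter_upwards [Ioi_mem_nhds (show x₀ / 2 < x₀ by linarith)] with x hx
      refine ae_of_all _ fun y => ?_
      have hx : x₀ / 2 < x := hx
      have h1 := hg.nonneg y
      have h4 : 0 < α / (x₀ / 4) := by positivity
      by_cases hy : y ∈ Iio (x / 2)
      · rw [indicator_of_mem hy, Real.norm_of_nonneg (mul_nonneg h1 (hg.nonneg _)), mul_comm]
        have hy : y < x / 2 := hy
        refine mul_le_mul_of_nonneg_right ((hg.mul_le _ (by linarith)).trans ?_) h1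
        exact div_le_div_of_nonneg_left hα₀.le (by linarith) (by linarith)
      · rw [indicator_of_notMem hy, norm_zero]
        positivity
    -- The cutoff jumps at this one null point; elsewhere the indicator is locally constant in `x`.
    · have hne : ∀ᵐ y : ℝ, y ≠ x₀ / 2 := by simp [ae_iff]
      filter_upwards [hne] with y hy
      rcases lt_or_gt_of_ne hy with hlt | hgt
      · have hev : (fun x => g y * g (x - y)) =ᶠ[𝓝 x₀]
            fun x => (Iio (x / 2)).indicator (fun y => g y * g (x - y)) y := by
          filter_upwards [Ioi_mem_nhds (show 2 * y < x₀ by linarith)] with x hx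
          have hx : 2 * y < x := hx
          rw [indicator_of_mem (show y ∈ Iio (x / 2) by simp only [mem_Iio]; linarith)]
        refine ContinuousAt.congr ?_ hev
        refine ContinuousAt.const_mul ?_ (g y) |>.congr (Eventually.of_forall fun _ => rfl)
        have hca : ContinuousAt g (x₀ - y) := hc.continuousAt (Ioi_mem_nhds (by linarith))
        exact ContinuousAt.comp (f := fun x => x - y) hca (by fun_prop)
      · have hev : (fun _ => 0) =ᶠ[𝓝 x₀]
            fun x => (Iio (x / 2)).indicator (fun y => g y * g (x - y)) y := by
          filter_upwards [Iio_mem_nhds (show x₀ < 2 * y by linarith)] with x hx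
          have hx : x < 2 * y := hx
          rw [indicator_of_notMem (show y ∉ Iio (x / 2) by simp only [mem_Iio]; linarith)]
        exact continuousAt_const.congr hev

/-- The integrated form of the equation `x g'(x) + (1 - α) g(x) = -α (g * g)(x - 1)`. -/
def IntegralEquation (α : ℝ) (g : ℝ → ℝ) : Prop :=
  ∀ x, 0 < x → x * g x = α * ((∫ y in Iic x, g y) - ∫ y in Iic (x - 1), conv g g y)

lemma IsTame.continuousOn (hg : IsTame α g) (heq : IntegralEquation α g) :
    ContinuousOn g (Ioi 0) := by
  have hN : Continuous fun x => α * ((∫ y in Iic x, g y) - ∫ y in Iic (x - 1), conv g g y) :=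
    continuous_const.mul ((continuous_setIntegral_Iic hg.integrable).sub
      ((continuous_setIntegral_Iic hg.integrable_conv).comp (continuous_id.sub continuous_const)))
  refine (hN.continuousOn.div continuousOn_id fun x hx => ne_of_gt hx).congr fun x hx => ?_
  have hx : 0 < x := hx
  simp only [id_eq, Pi.div_apply]
  rw [← heq x hx, mul_div_cancel_left₀ _ hx.ne']

/-- The only exceptional point is 1, where the convolution is evaluated at the origin. -/
lemma IsTame.hasDerivAt (hg : IsTame α g) (hα₀ : 0 < α) (heq : IntegralEquation α g) {x : ℝ}
    (hx : 0 < x) (hx1 : x ≠ 1) :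
    HasDerivAt g ((-α * conv g g (x - 1) - (1 - α) * g x) / x) x := by
  have hc := hg.continuousOn heq
  have h1 := hasDerivAt_setIntegral_Iic hg.integrable (hc.continuousAt (Ioi_mem_nhds hx))
  have h2 := (hasDerivAt_setIntegral_Iic hg.integrable_conv
    (hg.continuousAt_conv hα₀ hc (sub_ne_zero.2 hx1))).comp_sub_const x 1
  have h3 := ((h1.sub h2).const_mul α).div (hasDerivAt_id x) hx.ne'
  have hev : g =ᶠ[𝓝 x] fun x => α * ((∫ y in Iic x, g y) - ∫ y in Iic (x - 1), conv g g y) / x := by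
    filter_upwards [Ioi_mem_nhds hx] with t ht
    have ht : 0 < t := ht
    rw [← heq t ht, mul_div_cancel_left₀ _ ht.ne']
  refine (h3.congr_of_eventuallyEq hev).congr_deriv ?_
  simp only [id_eq, Pi.sub_apply, mul_one]
  rw [← heq x hx]
  field_simp
  ring

lemma IsTame.isContinuousSolution (hg : IsTame α g) (hα₀ : 0 < α) (heq : IntegralEquation α g) :
    IsContinuousSolution α g := by
  refine ⟨hg.eq_zero, hg.continuousOn heq, fun x hx hn => ?_⟩
  have h := hg.hasDerivAt hα₀ heq hx (by simpa using hn 1)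
  refine ⟨h.differentiableAt, ?_⟩
  rw [h.deriv]
  field_simp
  ring

/-- The integrating factor `x^{-α}` turns the left side of the equation into an exact derivative. -/
lemma hasDerivAt_rpow_mul {x c f' : ℝ} (hx : 0 < x) (hf : HasDerivAt f f' x)
    (h : x * f' + (1 - α) * f x = c) :
    HasDerivAt (fun x => x ^ (1 - α) * f x) (x ^ (-α) * c) x := by
  have h1 := (Real.hasDerivAt_rpow_const (p := 1 - α) (Or.inl hx.ne')).mul hf
  refine h1.congr_deriv ?_
  rw [← h, show 1 - α - 1 = -α by ring, show 1 - α = -α + 1 by ring, Real.rpow_add_one hx.ne']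
  ring

lemma continuousOn_rpow_mul (hf : ContinuousOn f (Ioi 0)) :
    ContinuousOn (fun x => x ^ (1 - α) * f x) (Ioi 0) :=
  ContinuousOn.mul (fun _ hx => (Real.continuousAt_rpow_const _ _
    (Or.inl (ne_of_gt hx))).continuousWithinAt) hf

lemma IsTame.antitoneOn (hg : IsTame α g) (hα₀ : 0 < α) (heq : IntegralEquation α g) :
    AntitoneOn (fun x => x ^ (1 - α) * g x) (Ioi 0) := by
  have hcont := continuousOn_rpow_mul (α := α) (hg.continuousOn heq)
  have hder : ∀ x, 0 < x → x ≠ 1 → HasDerivAt (fun x => x ^ (1 - α) * g x)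
      (x ^ (-α) * (-α * conv g g (x - 1))) x := fun x hx hx1 => by
    refine hasDerivAt_rpow_mul hx (hg.hasDerivAt hα₀ heq hx hx1) ?_
    field_simp
    ring
  have hneg : ∀ x, 0 < x → x ≠ 1 → deriv (fun x => x ^ (1 - α) * g x) x ≤ 0 := fun x hx hx1 => by
    rw [(hder x hx hx1).deriv]
    refine mul_nonpos_of_nonneg_of_nonpos (Real.rpow_nonneg hx.le _) ?_
    nlinarith [mul_nonneg hα₀.le (hg.conv_nonneg (x - 1))]
  have h1 : AntitoneOn (fun x => x ^ (1 - α) * g x) (Ioc 0 1) := by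
    refine antitoneOn_of_deriv_nonpos (convex_Ioc 0 1) (hcont.mono Ioc_subset_Ioi_self) ?_ ?_ <;>
    rw [interior_Ioc]
    · exact fun x hx => (hder x hx.1 hx.2.ne).differentiableAt.differentiableWithinAt
    · exact fun x hx => hneg x hx.1 hx.2.ne
  have h2 : AntitoneOn (fun x => x ^ (1 - α) * g x) (Ici 1) := by
    refine antitoneOn_of_deriv_nonpos (convex_Ici 1)
      (hcont.mono (Ici_subset_Ioi.2 zero_lt_one)) ?_ ?_ <;>
    rw [interior_Ici]
    · exact fun x hx => (hder x (zero_lt_one.trans hx) (ne_of_gt hx)).differentiableAt.differentiableWithinAt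
    · exact fun x hx => hneg x (zero_lt_one.trans hx) (ne_of_gt hx)
  have h3 := h1.union_right h2 ⟨⟨zero_lt_one, le_rfl⟩, fun x hx => hx.2⟩ isLeast_Ici
  rwa [Ioc_union_Ici_eq_Ioi zero_lt_one] at h3

lemma conv_congr_of_eqOn (hf : ∀ x ≤ 0, f x = 0) (hh : ∀ x ≤ 0, h x = 0) {t : ℝ}
    (heq : ∀ x, 0 < x → x < t → f x = h x) : conv f f t = conv h h t := by
  rw [conv_apply, conv_apply]
  refine integral_congr_ae (ae_of_all _ fun y => ?_)
  simp only
  rcases le_or_gt y 0 with hy | hy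
  · rw [hf y hy, hh y hy, zero_mul, zero_mul]
  rcases le_or_gt t y with hty | hty
  · rw [hf (t - y) (by linarith), hh (t - y) (by linarith), mul_zero, mul_zero]
  · rw [heq y hy hty, heq (t - y) (by linarith) (by linarith)]

lemma IsContinuousSolution.hasDerivAt (hf : IsContinuousSolution α f) {x : ℝ} (hx : 0 < x)
    (hn : ∀ n : ℕ, x ≠ n) :
    HasDerivAt (fun x => x ^ (1 - α) * f x) (x ^ (-α) * (-α * conv f f (x - 1))) x :=
  hasDerivAt_rpow_mul hx (hf.equation x hx hn).1.hasDerivAt (hf.equation x hx hn).2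

lemma ne_natCast_of_mem_Ioo {n : ℕ} {x : ℝ} (hx : x ∈ Ioo (n : ℝ) (n + 1)) (m : ℕ) : x ≠ m := by
  rintro rfl
  have h1 : n < m := by exact_mod_cast hx.1
  have h2 : m < n + 1 := by exact_mod_cast hx.2
  omega

/-- Inside the unit interval `x - 1 < n`, so both convolutions agree and the difference has zero
derivative; the mean value theorem carries this to the endpoints. -/
lemma IsContinuousSolution.rpow_mul_sub_eq (hf : IsContinuousSolution α f)
    (hh : IsContinuousSolution α h) (n : ℕ) (heq : ∀ x : ℝ, 0 < x → x < n → f x = h x) {a b : ℝ}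
    (ha₀ : 0 < a) (ha : n ≤ a) (hab : a < b) (hb : b ≤ n + 1) :
    b ^ (1 - α) * f b - b ^ (1 - α) * h b = a ^ (1 - α) * f a - a ^ (1 - α) * h a := by
  have hsub : Icc a b ⊆ Ioi 0 := fun x hx => ha₀.trans_le hx.1
  obtain ⟨c, -, hc⟩ := exists_hasDerivAt_eq_slope
    (fun x => x ^ (1 - α) * f x - x ^ (1 - α) * h x) (fun _ => 0) hab
    (((continuousOn_rpow_mul hf.continuousOn).sub (continuousOn_rpow_mul hh.continuousOn)).mono hsub)
    (fun x hx => by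
      have hx0 : 0 < x := ha₀.trans hx.1
      have hxn : ∀ m : ℕ, x ≠ m :=
        ne_natCast_of_mem_Ioo (n := n) ⟨ha.trans_lt hx.1, hx.2.trans_le hb⟩
      refine ((hf.hasDerivAt hx0 hxn).sub (hh.hasDerivAt hx0 hxn)).congr_deriv ?_
      rw [conv_congr_of_eqOn hf.eq_zero hh.eq_zero fun y hy hyt => heq y hy (by linarith [hx.2]),
        sub_self])
  rw [eq_comm, div_eq_zero_iff] at hc
  rcases hc with hc | hc <;> linarith

lemma tendsto_rpow_mul_of_isEquivalent {C : ℝ}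
    (hf : f ~[𝓝[>] 0] fun x => C * x ^ (α - 1)) :
    Tendsto (fun x => x ^ (1 - α) * f x) (𝓝[>] 0) (𝓝 C) := by
  have h1 : (fun x => x ^ (1 - α) * f x) ~[𝓝[>] 0] fun x => x ^ (1 - α) * (C * x ^ (α - 1)) :=
    IsEquivalent.refl.mul hf
  have h2 : (fun x => x ^ (1 - α) * (C * x ^ (α - 1))) =ᶠ[𝓝[>] 0] fun _ => C := by
    filter_upwards [self_mem_nhdsWithin] with x hx
    rw [mul_left_comm, ← Real.rpow_add hx, show 1 - α + (α - 1) = 0 by ring, Real.rpow_zero, mul_one]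
  exact (h1.congr_right h2).symm.tendsto_nhds tendsto_const_nhds

/-- A continuous solution is determined by its behaviour at the origin. -/
theorem IsContinuousSolution.eq_of_isEquivalent {C : ℝ} (hf : IsContinuousSolution α f)
    (hh : IsContinuousSolution α h) (hf₀ : f ~[𝓝[>] 0] fun x => C * x ^ (α - 1))
    (hh₀ : h ~[𝓝[>] 0] fun x => C * x ^ (α - 1)) : f = h := by
  have hcancel : ∀ x, 0 < x → x ^ (1 - α) * f x - x ^ (1 - α) * h x = 0 → f x = h x := by
    intro x hx he
    rw [← mul_sub, mul_eq_zero] at he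
    rcases he with he | he
    · exact absurd he (Real.rpow_pos_of_pos hx _).ne'
    · linarith
  have hstep : ∀ n : ℕ, ∀ x : ℝ, 0 < x → x ≤ n → f x = h x := by
    intro n
    induction n with
    | zero =>
      intro x hx hx'
      rw [Nat.cast_zero] at hx'
      linarith
    | succ n ih =>
      intro x hx hx'
      push_cast at hx'
      rcases le_or_gt x n with hxn | hxn
      · exact ih x hx hxn
      refine hcancel x hx ?_
      have hlt : ∀ y : ℝ, 0 < y → y < n → f y = h y := fun y hy hyn => ih y hy hyn.le
      rcases Nat.eq_zero_or_pos n with rfl | hn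
      -- On the first interval there is no earlier value to match; letting `a → 0⁺` uses the common
      -- asymptotics instead.
      · have hlim := (tendsto_rpow_mul_of_isEquivalent hf₀).sub (tendsto_rpow_mul_of_isEquivalent hh₀)
        rw [sub_self] at hlim
        refine tendsto_nhds_unique ?_ hlim
        refine tendsto_const_nhds.congr' ?_
        filter_upwards [Ioo_mem_nhdsGT hx] with a ha
        exact hf.rpow_mul_sub_eq hh 0 hlt ha.1 (by simpa using ha.1.le) ha.2 hx'
      · have hn0 : (0 : ℝ) < n := by exact_mod_cast hn
        rw [hf.rpow_mul_sub_eq hh n hlt hn0 le_rfl hxn hx', ih n hn0 le_rfl, sub_self]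
  funext x
  rcases le_or_gt x 0 with hx | hx
  · rw [hf.eq_zero x hx, hh.eq_zero x hx]
  · obtain ⟨n, hn⟩ := exists_nat_ge x
    exact hstep n x hx hn

end

/-! ### The constant `C₀` and uniqueness of the density -/

section

variable {α : ℝ} {μ : Measure ℝ} {g : ℝ → ℝ}

/-- The Beta integral `∫₀ˣ y^{α-1} (x-y)^{-α} dy = π / sin(απ)`. -/
lemma integral_rpow_mul_rpow_sub (hα₀ : 0 < α) (hα₁ : α < 1) {x : ℝ} (hx : 0 < x) :
    ∫ y in (0 : ℝ)..x, y ^ (α - 1) * (x - y) ^ (-α) = (C₀ α)⁻¹ := by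
  have h1 := Complex.betaIntegral_scaled (α : ℂ) ((1 - α : ℝ) : ℂ) hx
  have h2 := Complex.Gamma_mul_Gamma_eq_betaIntegral (s := (α : ℂ)) (t := ((1 - α : ℝ) : ℂ))
    (by simpa using hα₀) (by simpa using hα₁)
  have h3 : (α : ℂ) + ((1 - α : ℝ) : ℂ) = 1 := by push_cast; ring
  rw [h3, Complex.Gamma_one, one_mul, Complex.Gamma_ofReal, Complex.Gamma_ofReal,
    ← Complex.ofReal_mul, Real.Gamma_mul_Gamma_one_sub] at h2
  rw [h3, sub_self, Complex.cpow_zero, one_mul, ← h2] at h1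
  apply Complex.ofReal_injective
  rw [C₀, inv_div, mul_comm α, ← h1, ← intervalIntegral.integral_ofReal]
  rw [intervalIntegral.integral_of_le hx.le, intervalIntegral.integral_of_le hx.le]
  refine setIntegral_congr_fun measurableSet_Ioc fun y hy => ?_
  rw [Complex.ofReal_mul, Complex.ofReal_cpow hy.1.le, Complex.ofReal_cpow (sub_nonneg.2 hy.2)]
  congr 2 <;> push_cast <;> ring

/-- Comparison with the zero solution on `(0, 1]`, where the convolution term is absent. -/
lemma IsContinuousSolution.exists_eq_const_mul_rpow (hg : IsContinuousSolution α g) :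
    ∃ C, ∀ x ∈ Ioo (0 : ℝ) 1, g x = C * x ^ (α - 1) := by
  have hzero : IsContinuousSolution α fun _ => (0 : ℝ) :=
    ⟨fun _ _ => rfl, continuousOn_const, fun x _ _ => ⟨differentiableAt_const _, by
      simp [conv_apply]⟩⟩
  refine ⟨g 1, fun x hx => ?_⟩
  have h := hg.rpow_mul_sub_eq hzero 0 (fun y hy hy' => by
    rw [Nat.cast_zero] at hy'
    linarith) hx.1 (by simpa using hx.1.le) hx.2 (by simp)
  rw [Real.one_rpow, one_mul, mul_zero, mul_zero, sub_zero, sub_zero] at h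
  rw [h, mul_right_comm, ← Real.rpow_add hx.1, show 1 - α + (α - 1) = 0 by ring, Real.rpow_zero,
    one_mul]

/-- Normalisation comes from `k * μ`, whose density is 1 a.e. on `(0, 1)`: at one such point it
equals `C` times the Beta integral. -/
lemma IsLaw.eq_C₀_of_lawDensity_eq (hα₀ : 0 < α) (hα₁ : α < 1) (hμ : IsLaw α μ) (h0 : μ (Iio 0) = 0)
    {C : ℝ} (hC : ∀ x ∈ Ioo (0 : ℝ) 1, lawDensity α μ x = C * x ^ (α - 1)) : C = C₀ α := by
  have := hμ.isProbabilityMeasure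
  obtain ⟨x, hx, hxe⟩ := exists_mem_Ioo_of_ae (hμ.lintegral_kernelDensity hα₀ hα₁ h0) zero_lt_one
  have htail : tailDensity μ x = 1 := by
    rw [tailDensity, indicator_of_mem (show x ∈ Ioi 0 from hx.1), ← prob_compl_eq_zero_iff
      measurableSet_Ioi, compl_Ioi]
    refine measure_mono_null (fun z hz => ?_) h0
    simp only [mem_Iic, mem_Iio] at hz ⊢
    linarith [hx.2]
  have hm : Measurable fun y => kernelDensity α (x - y) :=
    (measurable_kernelDensity α).comp (measurable_const.sub measurable_id)
  rw [htail, ← hμ.withDensity_lawDensity hα₀ hα₁ h0, lintegral_withDensity_eq_lintegral_mul _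
    measurable_lawDensity.ennreal_ofReal hm] at hxe
  have hind : ∫⁻ y in Ioo 0 x, ENNReal.ofReal (C * (y ^ (α - 1) * (x - y) ^ (-α))) = 1 := by
    rw [← hxe, ← lintegral_indicator measurableSet_Ioo]
    refine lintegral_congr_ae ?_
    have hne : ∀ᵐ y : ℝ, y ≠ x := by simp [ae_iff]
    filter_upwards [hne] with y hyx
    rw [Pi.mul_apply]
    by_cases hy : y ∈ Ioo 0 x
    · rw [indicator_of_mem hy, kernelDensity, indicator_of_mem
        (show x - y ∈ Ioc (0 : ℝ) 1 from ⟨by linarith [hy.2], by linarith [hx.2, hy.1]⟩),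
        ← ENNReal.ofReal_mul (lawDensity_nonneg hα₀ _), hC y ⟨hy.1, hy.2.trans hx.2⟩, mul_assoc]
    · rw [indicator_of_notMem hy]
      rcases le_or_gt y 0 with hy0 | hy0
      · rw [lawDensity, if_neg (not_lt.2 hy0), ENNReal.ofReal_zero, zero_mul]
      · have hxy : x ≤ y := by
          by_contra hc
          exact hy ⟨hy0, not_le.1 hc⟩
        rw [kernelDensity, indicator_of_notMem, mul_zero]
        exact fun hmem => absurd hmem.1 (by linarith)
  have hCpos : 0 ≤ C := by
    have h1 := lawDensity_nonneg (μ := μ) hα₀ x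
    rw [hC x hx] at h1
    exact nonneg_of_mul_nonneg_left h1 (Real.rpow_pos_of_pos hx.1 _)
  have hint : ∫ y in Ioo 0 x, C * (y ^ (α - 1) * (x - y) ^ (-α)) = 1 := by
    rw [integral_eq_lintegral_of_nonneg_ae, hind, ENNReal.toReal_one]
    · filter_upwards [ae_restrict_mem measurableSet_Ioo] with y hy
      have := hy.1
      have := sub_pos.2 hy.2
      positivity
    · exact Measurable.aestronglyMeasurable (by fun_prop)
  rw [integral_const_mul, ← integral_Ioc_eq_integral_Ioo, ← intervalIntegral.integral_of_le hx.1.le,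
    integral_rpow_mul_rpow_sub hα₀ hα₁ hx.1] at hint
  exact eq_of_mul_inv_eq_one hint

lemma IsDensity.unique {g₁ g₂ : ℝ → ℝ} (h₁ : IsDensity α g₁) (h₂ : IsDensity α g₂) : g₁ = g₂ := by
  have hmeas : ∀ g : ℝ → ℝ, IsDensity α g → Measurable g := fun g hg => by
    have : g = (Ioi (0 : ℝ)).indicator g := by
      funext x
      by_cases hx : x ∈ Ioi (0 : ℝ)
      · rw [indicator_of_mem hx]
      · rw [indicator_of_notMem hx, hg.eq_zero x (not_lt.1 hx)]
    rw [this]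
    exact hg.continuousOn.measurable_piecewise continuousOn_const measurableSet_Ioi
  have := h₁.isLaw.isProbabilityMeasure
  have := h₂.isLaw.isProbabilityMeasure
  have hμ := Measure.ext_of_charFun (funext fun s =>
    (h₁.isLaw.charFun_eq s).trans (h₂.isLaw.charFun_eq s).symm)
  have hae := (withDensity_eq_iff (hmeas g₁ h₁).ennreal_ofReal.aemeasurable
    (hmeas g₂ h₂).ennreal_ofReal.aemeasurable (by
      rw [← setLIntegral_univ, ← withDensity_apply _ MeasurableSet.univ, measure_univ]
      exact ENNReal.one_ne_top)).1 hμ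
  have hae' : g₁ =ᵐ[volume.restrict (Ioi 0)] g₂ := by
    refine ae_restrict_of_ae ?_
    filter_upwards [hae] with x hx
    exact (ENNReal.ofReal_eq_ofReal_iff (h₁.nonneg x) (h₂.nonneg x)).1 hx
  have heq := Measure.eqOn_of_ae_eq hae' h₁.continuousOn h₂.continuousOn
    (by rw [interior_Ioi]; exact subset_closure)
  funext x
  rcases le_or_gt x 0 with hx | hx
  · rw [h₁.eq_zero x hx, h₂.eq_zero x hx]
  · exact heq hx

end

end DarlingMandelbrot

end

theorem theorem3 (α : ℝ) (hα₀ : 0 < α) (hα₁ : α < 1) :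
    -- the Darling–Mandelbrot law has exactly one density that is continuous on `(0, ∞)`
    (∃! g : ℝ → ℝ, DarlingMandelbrot.IsDensity α g) ∧
    ∀ g : ℝ → ℝ, DarlingMandelbrot.IsDensity α g →
      -- it solves the equation, in which the convolution is a convergent integral
      (∀ x : ℝ, ConvolutionExistsAt g g x (ContinuousLinearMap.mul ℝ ℝ) volume) ∧
      DarlingMandelbrot.IsContinuousSolution α g ∧
      -- its behaviour at `0`
      (fun x => g x - DarlingMandelbrot.C₀ α * x ^ (α - 1)) =O[𝓝[>] 0] (fun _ => (1 : ℝ)) ∧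
      g ~[𝓝[>] 0] (fun x => DarlingMandelbrot.C₀ α * x ^ (α - 1)) ∧
      -- uniqueness
      (∀ f : ℝ → ℝ, DarlingMandelbrot.IsContinuousSolution α f →
        f ~[𝓝[>] 0] (fun x => DarlingMandelbrot.C₀ α * x ^ (α - 1)) → f = g) ∧
      AntitoneOn (fun x => x ^ (1 - α) * g x) (Ioi 0) := by
  obtain ⟨μ, hμ, h0⟩ := DarlingMandelbrot.exists_isLaw hα₀ hα₁
  have ht := hμ.isTame_lawDensity hα₀ hα₁ h0
  have heq : DarlingMandelbrot.IntegralEquation α (DarlingMandelbrot.lawDensity α μ) :=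
    fun x hx => hμ.mul_lawDensity hα₀ hα₁ h0 hx
  have hsol := ht.isContinuousSolution hα₀ heq
  have hd : DarlingMandelbrot.IsDensity α (DarlingMandelbrot.lawDensity α μ) :=
    ⟨ht.nonneg, ht.eq_zero, ht.continuousOn heq, by
      rwa [hμ.withDensity_lawDensity hα₀ hα₁ h0]⟩
  refine ⟨⟨_, hd, fun g hg => hg.unique hd⟩, fun g hg => ?_⟩
  obtain rfl := hg.unique hd
  obtain ⟨C, hC⟩ := hsol.exists_eq_const_mul_rpow
  obtain rfl := hμ.eq_C₀_of_lawDensity_eq hα₀ hα₁ h0 hC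
  have hev : DarlingMandelbrot.lawDensity α μ =ᶠ[𝓝[>] 0]
      fun x => DarlingMandelbrot.C₀ α * x ^ (α - 1) := by
    filter_upwards [Ioo_mem_nhdsGT (zero_lt_one (α := ℝ))] with x hx using hC x hx
  refine ⟨ht.convolutionExistsAt, hsol, ?_, hev.isEquivalent, fun f hf hf₀ =>
    hf.eq_of_isEquivalent hsol hf₀ hev.isEquivalent, ht.antitoneOn hα₀ heq⟩
  -- The error term is identically 0 on `(0, 1)`, which is more than `O(1)`.
  refine (isBigO_zero _ _).congr' ?_ EventuallyEq.rfl
  filter_upwards [hev] with x hx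
  rw [hx, sub_self]
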